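/- Let $n,d,\tilde d\in\mathbb N=\{1,2,\dots\}$. Let $\varepsilon_i$, $i\in\mathbb Z$, be i.i.d. random vectors in $\mathbb R^{\tilde d}$, and for each $k\in\mathbb Z$ let $\varepsilon_k^*$ have the law of $\varepsilon_k$ and be independent of $(\varepsilon_i)_{i\in\mathbb Z}$. Let $X_i=J_i(\varepsilon_i,\varepsilon_{i-1},\dots)\in\mathbb R^d$ with measurable $J_i$, $i \in \mathbb Z$, and $Z_i=(X_i,X_{i-1},\dots)$. Let $\mathcal F$ be a finite nonempty class of measurable functions $f:(\mathbb R^d)^{\mathbb N_0}\times[0,1]\to\mathbb R$ of the form $f(z,u)=D_f(u)\bar f(z,u)$; put $H=\max\{1,\log|\mathcal F|\}$ and $D^\infty(u)=\max_{f\in\mathcal F}|D_f(u)|$. Let $(\Delta(k))_{k\ge 0}$ be a nonincreasing, nonnegative, summable sequence, and let $\mathbb D_n,\mathbb D_n^\infty$ be numbers with $$\Big(\tfrac1n\sum_{i=1}^n D_f(\tfrac in)^2\Big)^{1/2}\le\mathbb D_n\ (f\in\mathcal F),\qquad \Big(\tfrac1n\sum_{i=1}^n D^\infty(\tfrac in)^2\Big)^{1/2}\le\mathbb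 D_n^\infty.$$ Write $\|Y\|_s=\mathbb E[|Y|^s]^{1/s}$ ($\|Y\|_\infty$ the essential supremum), and $$\|f\|_{2,n}=\Big(\tfrac1n\sum_{i=1}^n\|f(Z_i,\tfrac in)\|_2^2\Big)^{1/2},\quad V(f)=\|f\|_{2,n}+\sum_{k=1}^\infty\min\{\|f\|_{2,n},\mathbb D_n\Delta(k)\},\quad \beta(q)=\sum_{j=q}^\infty\Delta(j).$$ For $i=1,\dots,n$ and measurable $f$ let $W_i(f)$ be a real random variable that is a measurable function of $(\varepsilon_i,\varepsilon_{i-1},\dots)$, and let $W_i(f)^{*(i-j)}$ be the same function evaluated at the sequence in which $\varepsilon_{i-j}$ is replaced by $\varepsilon_{i-j}^*$. Assume that, almost surely, $W_i(f_1+f_2)=W_i(f_1)+W_i(f_2)$, and $|W_i(f)|\le W_i(g)$ whenever $|f|\le g$, for all measurable $f_1,f_2,f,g$ whose values at $(Z_i,\frac in)$ are integrable; and that for all $i=1,\dots,n$, $j\in\mathbb N$, $s\in\mathbb N\cup\{\infty\}$, $f\in\mathcal F$, $$\Big\|\max_{g\in\mathcal F}|W_i(g)-W_i(g)^{*(i-j)}|\Big\|_2\le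 D^\infty(\tfrac in)\Delta(j),\quad \|W_i(f)-W_i(f)^{*(i-j)}\|_2\le|D_f(\tfrac in)|\Delta(j),\quad \|W_i(f)\|_s\le\|f(Z_i,\tfrac in)\|_s.$$ Let $S_n^W(f)=\sum_{i=1}^n\{W_i(f)-\mathbb E W_i(f)\}$. Then there is a universal constant $c>0$ (depending on none of the above) such that the following holds. If $\sup_{f\in\mathcal F}\|f\|_\infty\le M$ (with $\|\cdot\|_\infty$ the supremum norm) and $\sup_{f\in\mathcal F}V(f)\le\sigma$, then $\max_{f\in\mathcal F}|n^{-1/2}S_n^W(f)|$ is integrable and $$\mathbb E\max_{f\in\mathcal F}\Big|\tfrac{1}{\sqrt n}S_n^W(f)\Big|\le c\cdot\min_{q\in\{1,\dots,n\}}\Big[\sigma\sqrt H+\sqrt H\,\mathbb D_n^\infty\beta(q)+\frac{qMH}{\sqrt n}\Big].$$ Moreover, with $q^*(x)=\min\{q\in\mathbb N:\beta(q)\le qx\}$ for $x>0$, if $M>0$ and $\mathbb D_n^\infty>0$, then with the same $c$ $$\mathbb E\max_{f\in\mathcal F}\Big|\tfrac{1}{\sqrt n}S_n^W(f)\Big|\le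 2c\Big(\sigma\sqrt H+q^*\Big(\frac{M\sqrt H}{\sqrt n\,\mathbb D_n^\infty}\Big)\frac{MH}{\sqrt n}\Big).$$ -/

import Mathlib

open MeasureTheory ProbabilityTheory
open scoped ENNReal

namespace MaximalInequality

noncomputable section

/-- Functions `f(z, u)` of a sequence `z = (z₀, z₁, …)` of vectors of `ℝᵈ` and of a rescaled
time `u ∈ [0,1]`. -/
abbrev Fn (d : ℕ) : Type := (ℕ → Fin d → ℝ) × unitInterval → ℝ

/-- The indices `i : Fin n` stand for the time points `1, …, n`:
the integer time `i + 1`. -/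
def time {n : ℕ} (i : Fin n) : ℤ := (i : ℤ) + 1

/-- The rescaled time point `(i + 1) / n ∈ [0,1]` that belongs to the integer time `i + 1`. -/
def grid {n : ℕ} (i : Fin n) : unitInterval :=
  ⟨((i : ℝ) + 1) / n, by
    have hn : (0 : ℝ) < n := by exact_mod_cast (Nat.zero_le _).trans_lt i.isLt
    have hi : (i : ℝ) + 1 ≤ n := by exact_mod_cast i.isLt
    exact ⟨by positivity, (div_le_one hn).2 hi⟩⟩

section Innovations

variable {Ω : Type*} {d d' : ℕ}

/-- `(ε_i, ε_{i-1}, ε_{i-2}, …)`. -/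
def past (ε : ℤ → Ω → Fin d' → ℝ) (i : ℤ) (ω : Ω) : ℕ → Fin d' → ℝ :=
  fun k => ε (i - k) ω

/-- `(ε_i, …, ε_{i-j+1}, ε*_{i-j}, ε_{i-j-1}, …)`: the past of time `i`
with the innovation of time `i - j` replaced by its copy. -/
def pastStar (ε ε' : ℤ → Ω → Fin d' → ℝ) (i : ℤ) (j : ℕ) (ω : Ω) : ℕ → Fin d' → ℝ :=
  Function.update (past ε i ω) j (ε' (i - j) ω)

/-- The innovations `ε_i`, `i ∈ ℤ`, are i.i.d., and each `ε*_k` has the law of `ε_k` and is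
independent of the whole sequence `(ε_i)_{i ∈ ℤ}`. -/
structure IsInnovation [MeasurableSpace Ω] (P : Measure Ω)
    (ε ε' : ℤ → Ω → Fin d' → ℝ) : Prop where
  measurable : ∀ i, Measurable (ε i)
  measurable_copy : ∀ k, Measurable (ε' k)
  indep : iIndepFun ε P
  ident : ∀ i k, IdentDistrib (ε i) (ε k) P P
  copy_ident : ∀ k, IdentDistrib (ε' k) (ε k) P P
  copy_indep : ∀ k, IndepFun (ε' k) (fun ω i => ε i ω) P

/-- The observed process `X_i = J_i(ε_i, ε_{i-1}, …)`. -/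
def X (J : ℤ → (ℕ → Fin d' → ℝ) → Fin d → ℝ) (ε : ℤ → Ω → Fin d' → ℝ) (i : ℤ) (ω : Ω) :
    Fin d → ℝ :=
  J i (past ε i ω)

/-- `Z_i = (X_i, X_{i-1}, X_{i-2}, …)`. -/
def Z (J : ℤ → (ℕ → Fin d' → ℝ) → Fin d → ℝ) (ε : ℤ → Ω → Fin d' → ℝ) (i : ℤ) (ω : Ω) :
    ℕ → Fin d → ℝ :=
  fun k => X J ε (i - k) ω

/-- The random variable `f(Z_i, i/n)`. -/
def obs (J : ℤ → (ℕ → Fin d' → ℝ) → Fin d → ℝ) (ε : ℤ → Ω → Fin d' → ℝ) {n : ℕ} (i : Fin n)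
    (f : Fn d) (ω : Ω) : ℝ :=
  f (Z J ε (time i) ω, grid i)

/-- `‖f‖_{2,n} = (n⁻¹ ∑_{i=1}^n ‖f(Z_i, i/n)‖₂²)^{1/2}`. -/
def normTwo [MeasurableSpace Ω] (P : Measure Ω) (n : ℕ)
    (J : ℤ → (ℕ → Fin d' → ℝ) → Fin d → ℝ) (ε : ℤ → Ω → Fin d' → ℝ) (f : Fn d) : ℝ :=
  Real.sqrt ((n : ℝ)⁻¹ * ∑ i : Fin n, ∫ ω, (obs J ε i f ω) ^ 2 ∂P)

/-- `V(f) = ‖f‖_{2,n} + ∑_{k=1}^∞ min{‖f‖_{2,n}, 𝔻_n Δ(k)}`; here `Dn` is `𝔻_n`. -/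
def V [MeasurableSpace Ω] (P : Measure Ω) (n : ℕ)
    (J : ℤ → (ℕ → Fin d' → ℝ) → Fin d → ℝ) (ε : ℤ → Ω → Fin d' → ℝ) (Δ : ℕ → ℝ) (Dn : ℝ)
    (f : Fn d) : ℝ :=
  normTwo P n J ε f + ∑' k : ℕ, min (normTwo P n J ε f) (Dn * Δ (k + 1))

/-- A functional `W`: `W i f` is the function of the past for which
`W_i(f) = W i f (ε_i, ε_{i-1}, …)`. This is the random variable `W_i(f)`. -/
def Wvar (ε : ℤ → Ω → Fin d' → ℝ) {n : ℕ} (W : Fin n → Fn d → (ℕ → Fin d' → ℝ) → ℝ)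
    (i : Fin n) (f : Fn d) (ω : Ω) : ℝ :=
  W i f (past ε (time i) ω)

/-- The coupled random variable `W_i(f)^{*(i-j)}`. -/
def WvarStar (ε ε' : ℤ → Ω → Fin d' → ℝ) {n : ℕ} (W : Fin n → Fn d → (ℕ → Fin d' → ℝ) → ℝ)
    (i : Fin n) (j : ℕ) (f : Fn d) (ω : Ω) : ℝ :=
  W i f (pastStar ε ε' (time i) j ω)

/-- `S_n^W(f) = ∑_{i=1}^n (W_i(f) - 𝔼 W_i(f))`. -/
def S [MeasurableSpace Ω] (P : Measure Ω) (ε : ℤ → Ω → Fin d' → ℝ) {n : ℕ}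
    (W : Fin n → Fn d → (ℕ → Fin d' → ℝ) → ℝ) (f : Fn d) (ω : Ω) : ℝ :=
  ∑ i : Fin n, (Wvar ε W i f ω - ∫ ω', Wvar ε W i f ω' ∂P)

/-- `max_{f ∈ 𝓕} |n^{-1/2} S_n^W(f)|`. -/
def maxS [MeasurableSpace Ω] (P : Measure Ω) (ε : ℤ → Ω → Fin d' → ℝ) {n : ℕ}
    (W : Fin n → Fn d → (ℕ → Fin d' → ℝ) → ℝ) (F : Finset (Fn d)) (hF : F.Nonempty)
    (ω : Ω) : ℝ :=
  F.sup' hF fun f => |S P ε W f ω / Real.sqrt n|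

end Innovations

/-- `D_n^∞(u) = max_{f ∈ 𝓕} |D_{f,n}(u)|`. -/
def Dinf {d : ℕ} (F : Finset (Fn d)) (hF : F.Nonempty) (D : Fn d → unitInterval → ℝ)
    (u : unitInterval) : ℝ :=
  F.sup' hF fun f => |D f u|

/-- `H = 1 ∨ log |𝓕|`. -/
def H {d : ℕ} (F : Finset (Fn d)) : ℝ := max 1 (Real.log F.card)

/-- `β(q) = ∑_{j=q}^∞ Δ(j)`. -/
def beta (Δ : ℕ → ℝ) (q : ℕ) : ℝ := ∑' j : ℕ, Δ (q + j)

/-- `q*(x) = min {q ∈ {1, 2, …} : β(q) ≤ q x}`. -/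
def qStar (Δ : ℕ → ℝ) (x : ℝ) : ℕ := sInf {q : ℕ | 1 ≤ q ∧ beta Δ q ≤ q * x}

/-- The conditions on the random variables `W_i(f)`. Additivity and domination are only asked
for measurable functions such that `f(Z_i, i/n)` is integrable, and only almost surely, so that
`W_i(f) = 𝔼[f(Z_i, i/n) | ε_{i-1}, ε_{i-2}, …]` is covered as well as `W_i(f) = f(Z_i, i/n)`. -/
structure Compatible {Ω : Type*} [MeasurableSpace Ω] (P : Measure Ω) {d d' n : ℕ}
    (ε ε' : ℤ → Ω → Fin d' → ℝ) (J : ℤ → (ℕ → Fin d' → ℝ) → Fin d → ℝ)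
    (F : Finset (Fn d)) (hF : F.Nonempty) (D : Fn d → unitInterval → ℝ) (Δ : ℕ → ℝ)
    (W : Fin n → Fn d → (ℕ → Fin d' → ℝ) → ℝ) : Prop where
  measurable : ∀ i f, Measurable f → Measurable (W i f)
  add : ∀ i f₁ f₂, Measurable f₁ → Measurable f₂ →
    Integrable (obs J ε i f₁) P → Integrable (obs J ε i f₂) P →
    ∀ᵐ ω ∂P, Wvar ε W i (f₁ + f₂) ω = Wvar ε W i f₁ ω + Wvar ε W i f₂ ω
  dom : ∀ i f g, Measurable f → Measurable g →
    Integrable (obs J ε i f) P → Integrable (obs J ε i g) P → (∀ x, |f x| ≤ g x) →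
    ∀ᵐ ω ∂P, |Wvar ε W i f ω| ≤ Wvar ε W i g ω
  sup_dep : ∀ i, ∀ j : ℕ, 1 ≤ j →
    eLpNorm (fun ω => F.sup' hF fun f => |Wvar ε W i f ω - WvarStar ε ε' W i j f ω|) 2 P
      ≤ ENNReal.ofReal (Dinf F hF D (grid i) * Δ j)
  dep : ∀ i, ∀ j : ℕ, 1 ≤ j → ∀ f ∈ F,
    eLpNorm (fun ω => Wvar ε W i f ω - WvarStar ε ε' W i j f ω) 2 P
      ≤ ENNReal.ofReal (|D f (grid i)| * Δ j)
  norm_le : ∀ i, ∀ s : ℕ∞, 1 ≤ s → ∀ f ∈ F,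
    eLpNorm (Wvar ε W i f) (s : ℝ≥0∞) P ≤ eLpNorm (obs J ε i f) (s : ℝ≥0∞) P

end

end MaximalInequality

/-!
The process `W_i(f)` is approximated by `W_{i,m}(f) = 𝔼[W_i(f) | ε_i, …, ε_{i-m+1}]` (`approx`),
which depends on `m` innovations only; `W_{i,0}(f)` is the mean of `W_i(f)`, and by Lévy's upward
theorem `W_{i,m}(f) → W_i(f)` in `L¹` as `m → ∞`. The increment `W_{i,m+1} - W_{i,m}` (`incr`) is a
conditional expectation of `W_i - W_i^{*(i-m)}`, so by Jensen's inequality the dependence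
coefficients bound its second moment (`integral_sup_incr_sq_le`). For fixed `m`, the increments form
a martingale difference sequence in `i` when time is run backwards (`integral_mul_incr`).

For a given `q ≥ 1` the sum of the `W_i(f) - 𝔼 W_i(f)` is split at depth `q`.

* The part `∑_i (W_i - W_{i,q})` is the sum over `m ≥ q` of vector-valued martingales. The function
  `x ↦ λ⁻¹ log ∑_f (e^{λ x_f} + e^{-λ x_f})` dominates the maximum norm, equals
  `λ⁻¹ log (2 |𝓕|)` at `0`, and has a second derivative of order `λ` with respect to the maximum
  norm. Following it along a martingale and choosing `λ` gives a maximal inequality with the factor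
  `√H` and the second moments of the maxima of the differences
  (`integral_sup_abs_sum_le_of_martingaleDifference`). Summation over `m ≥ q` leads to
  `√H 𝔻_n^∞ β(q)`.
* The part `∑_i (W_{i,q} - W_{i,0})` is the sum of the layers `W_{i,q} - W_{i,q/2}`,
  `W_{i,q/2} - W_{i,q/4}`, …. In a layer with end point `q` the times are grouped in blocks of
  length `q`; blocks with numbers of equal parity are independent, bounded by `2 q M`, and a
  Bernstein type maximal inequality applies (`integral_sup_abs_sum_le_of_indep`). By Minkowski's
  inequality and the orthogonality of the increments in `i`, the variance of a layer is at most
  `n (∑ min{‖f‖_{2,n}, 𝔻_n Δ(m)})²` with the sum over its depths `m`, where the term of depth `0` is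
  `‖f‖_{2,n}`. Since the terms are monotone in `‖f‖_{2,n}`, a single `f` is the worst case for all
  layers, and the standard deviations of all layers add up to at most `√n V(f)`. The terms `q M H`
  form a geometric series (`maxNorm_sum_approx_le`).

The assumption `‖W_i(f)‖_∞ ≤ ‖f(Z_i, i/n)‖_∞ ≤ M` allows one to truncate the functionals to
`[-M, M]` without changing `W_i(f)`. Truncation is `1`-Lipschitz, so that the
dependence coefficients of the truncated functionals are no larger.
-/

namespace MaximalInequality

noncomputable section

/-! ### Bounded measurable random variables -/

/-- `Y` is a bounded real function, measurable for the `σ`-algebra `m`. All random variables of the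
proof are of this kind after truncation, which makes every integrability condition automatic. -/
def BddMeas {Ω : Type*} (m : MeasurableSpace Ω) (Y : Ω → ℝ) : Prop :=
  Measurable[m] Y ∧ ∃ C, ∀ ω, |Y ω| ≤ C

namespace BddMeas

variable {Ω : Type*} {m m' : MeasurableSpace Ω} {Y Y' : Ω → ℝ}

lemma mono (h : m ≤ m') (hY : BddMeas m Y) : BddMeas m' Y := ⟨hY.1.mono h le_rfl, hY.2⟩

lemma const (c : ℝ) : BddMeas m (fun _ : Ω => c) := ⟨measurable_const, |c|, fun _ => le_rfl⟩

lemma add (hY : BddMeas m Y) (hY' : BddMeas m Y') : BddMeas m (fun ω => Y ω + Y' ω) := by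
  obtain ⟨h, C, hC⟩ := hY
  obtain ⟨h', C', hC'⟩ := hY'
  exact ⟨h.add h', C + C', fun ω => (abs_add_le _ _).trans (add_le_add (hC ω) (hC' ω))⟩

lemma mul (hY : BddMeas m Y) (hY' : BddMeas m Y') : BddMeas m (fun ω => Y ω * Y' ω) := by
  obtain ⟨h, C, hC⟩ := hY
  obtain ⟨h', C', hC'⟩ := hY'
  refine ⟨h.mul h', C * C', fun ω => ?_⟩
  rw [abs_mul]
  exact mul_le_mul (hC ω) (hC' ω) (abs_nonneg _) ((abs_nonneg _).trans (hC ω))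

lemma const_mul (c : ℝ) (hY : BddMeas m Y) : BddMeas m (fun ω => c * Y ω) := (const c).mul hY

lemma neg (hY : BddMeas m Y) : BddMeas m (fun ω => -Y ω) := by
  simpa using hY.const_mul (-1)

lemma sub (hY : BddMeas m Y) (hY' : BddMeas m Y') : BddMeas m (fun ω => Y ω - Y' ω) := by
  simpa [sub_eq_add_neg] using hY.add hY'.neg

lemma pow_two (hY : BddMeas m Y) : BddMeas m (fun ω => Y ω ^ 2) := by
  simpa [sq] using hY.mul hY

lemma abs (hY : BddMeas m Y) : BddMeas m (fun ω => |Y ω|) := by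
  obtain ⟨h, C, hC⟩ := hY
  exact ⟨h.abs, C, fun ω => by simpa using hC ω⟩

lemma exp (hY : BddMeas m Y) : BddMeas m (fun ω => Real.exp (Y ω)) := by
  obtain ⟨h, C, hC⟩ := hY
  refine ⟨h.exp, Real.exp C, fun ω => ?_⟩
  rw [Real.abs_exp]
  exact Real.exp_le_exp.2 ((le_abs_self _).trans (hC ω))

lemma sum {κ : Type*} {s : Finset κ} {Y : κ → Ω → ℝ} (h : ∀ k ∈ s, BddMeas m (Y k)) :
    BddMeas m (fun ω => ∑ k ∈ s, Y k ω) := by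
  classical
  induction s using Finset.induction_on with
  | empty => simpa using const 0
  | insert a s ha ih =>
    simp only [Finset.sum_insert ha]
    exact (h a (Finset.mem_insert_self a s)).add
      (ih fun k hk => h k (Finset.mem_insert_of_mem hk))

lemma sup' {κ : Type*} {s : Finset κ} (hs : s.Nonempty) {Y : κ → Ω → ℝ}
    (h : ∀ k ∈ s, BddMeas m (Y k)) : BddMeas m (fun ω => s.sup' hs fun k => Y k ω) := by
  obtain ⟨-, C, hC⟩ := sum fun k hk => (h k hk).abs
  refine ⟨?_, C, fun ω => (abs_le.2 ⟨?_, ?_⟩ : _ ≤ ∑ k ∈ s, |Y k ω|).trans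
    ((le_abs_self _).trans (hC ω))⟩
  · have := Finset.measurable_sup' hs fun k hk => (h k hk).1
    convert this using 2 with ω
    rw [Finset.sup'_apply]
  · obtain ⟨k, hk⟩ := hs
    refine le_trans ?_ (Finset.le_sup' (fun k => Y k ω) hk)
    exact neg_le.2 ((neg_le_abs _).trans
      (Finset.single_le_sum (f := fun k => |Y k ω|) (fun _ _ => abs_nonneg _) hk))
  · exact Finset.sup'_le hs _ fun k hk => (le_abs_self _).trans
      (Finset.single_le_sum (f := fun k => |Y k ω|) (fun _ _ => abs_nonneg _) hk)

lemma integrable {mΩ : MeasurableSpace Ω} {P : Measure Ω} [IsFiniteMeasure P]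
    (hY : BddMeas mΩ Y) : Integrable Y P := by
  obtain ⟨h, C, hC⟩ := hY
  exact Integrable.of_bound h.aestronglyMeasurable C (Filter.Eventually.of_forall hC)

lemma comp {Ω' : Type*} {mΩ' : MeasurableSpace Ω'} {G : Ω' → ℝ} {U : Ω → Ω'}
    (hG : BddMeas mΩ' G) (hU : Measurable[m] U) : BddMeas m (fun ω => G (U ω)) :=
  ⟨hG.1.comp hU, hG.2.imp fun _ h ω => h (U ω)⟩

end BddMeas

/-! ### Exponential potentials -/

lemma exp_le_add_exp_sq (z : ℝ) : Real.exp z ≤ z + Real.exp (z ^ 2) := by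
  have h1 := Real.add_one_le_exp (z ^ 2)
  rcases le_or_gt |z| 1 with h | h
  · have := (abs_le.1 (Real.abs_exp_sub_one_sub_id_le h)).2
    linarith
  · rcases lt_abs.1 h with h | h
    · have := Real.exp_le_exp.2 (show z ≤ z ^ 2 by nlinarith)
      linarith
    · have := Real.exp_le_one_iff.2 (show z ≤ 0 by linarith)
      nlinarith

/-- The weights `e^{x_k} / ∑ e^{x_l}`: the gradient of `x ↦ log ∑ e^{x_k}`. -/
def softmax {κ : Type*} (K : Finset κ) (x : κ → ℝ) (k : κ) : ℝ :=
  Real.exp (x k) / ∑ l ∈ K, Real.exp (x l)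

section

variable {κ : Type*} {K : Finset κ}

lemma sum_exp_pos (hK : K.Nonempty) (x : κ → ℝ) : 0 < ∑ l ∈ K, Real.exp (x l) :=
  Finset.sum_pos (fun _ _ => Real.exp_pos _) hK

lemma sum_softmax (hK : K.Nonempty) (x : κ → ℝ) : ∑ k ∈ K, softmax K x k = 1 := by
  unfold softmax
  rw [← Finset.sum_div, div_self (sum_exp_pos hK x).ne']

lemma softmax_nonneg (x : κ → ℝ) (k : κ) : 0 ≤ softmax K x k :=
  div_nonneg (Real.exp_pos _).le (Finset.sum_nonneg fun _ _ => (Real.exp_pos _).le)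

lemma softmax_le_one {k : κ} (hk : k ∈ K) (x : κ → ℝ) : softmax K x k ≤ 1 := by
  rw [← sum_softmax ⟨k, hk⟩ x]
  exact Finset.single_le_sum (f := softmax K x) (fun l _ => softmax_nonneg x l) hk

/-- The potential `x ↦ log ∑ e^{x_k}` is smooth with respect to the maximum norm: a step `y` exceeds
its linear part by at most a multiple of `‖y‖²`, with a constant that does not depend on the
dimension. -/
lemma log_sum_exp_add_le (hK : K.Nonempty) (x y : κ → ℝ) {B : ℝ} (hy : ∀ k ∈ K, |y k| ≤ B) :
    Real.log (∑ k ∈ K, Real.exp (x k + y k)) ≤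
      Real.log (∑ k ∈ K, Real.exp (x k)) + ∑ k ∈ K, softmax K x k * y k + 4 * B ^ 2 := by
  set Z := ∑ k ∈ K, Real.exp (x k) with hZ
  have hZ0 : 0 < Z := sum_exp_pos hK x
  set μ := ∑ k ∈ K, softmax K x k * y k with hμ
  have hμB : |μ| ≤ B := by
    calc |μ| ≤ ∑ k ∈ K, |softmax K x k * y k| := Finset.abs_sum_le_sum_abs _ _
      _ ≤ ∑ k ∈ K, softmax K x k * B := Finset.sum_le_sum fun k hk => by
          rw [abs_mul, abs_of_nonneg (softmax_nonneg x k)]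
          exact mul_le_mul_of_nonneg_left (hy k hk) (softmax_nonneg x k)
      _ = B := by rw [← Finset.sum_mul, sum_softmax hK, one_mul]
  have hsum : ∑ k ∈ K, softmax K x k * Real.exp (y k - μ) ≤ Real.exp (4 * B ^ 2) := by
    calc ∑ k ∈ K, softmax K x k * Real.exp (y k - μ)
        ≤ ∑ k ∈ K, softmax K x k * ((y k - μ) + Real.exp (4 * B ^ 2)) := by
          refine Finset.sum_le_sum fun k hk => mul_le_mul_of_nonneg_left ?_ (softmax_nonneg x k)
          refine (exp_le_add_exp_sq _).trans (add_le_add le_rfl (Real.exp_le_exp.2 ?_))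
          have h1 := abs_le.1 (hy k hk)
          have h2 := abs_le.1 hμB
          nlinarith
      _ = (∑ k ∈ K, softmax K x k * y k) - (∑ k ∈ K, softmax K x k) * μ
            + (∑ k ∈ K, softmax K x k) * Real.exp (4 * B ^ 2) := by
          rw [Finset.sum_mul, Finset.sum_mul, ← Finset.sum_sub_distrib, ← Finset.sum_add_distrib]
          exact Finset.sum_congr rfl fun k _ => by ring
      _ = Real.exp (4 * B ^ 2) := by rw [sum_softmax hK, ← hμ]; ring
  have hle : ∑ k ∈ K, Real.exp (x k + y k) ≤ Z * Real.exp (μ + 4 * B ^ 2) := by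
    have : ∑ k ∈ K, Real.exp (x k + y k)
        = Z * Real.exp μ * ∑ k ∈ K, softmax K x k * Real.exp (y k - μ) := by
      rw [Finset.mul_sum]
      refine Finset.sum_congr rfl fun k _ => ?_
      have h1 : softmax K x k = Real.exp (x k) / Z := rfl
      rw [h1, Real.exp_sub, Real.exp_add]
      field_simp
    rw [this, Real.exp_add, ← mul_assoc]
    exact mul_le_mul_of_nonneg_left hsum (by positivity)
  calc Real.log (∑ k ∈ K, Real.exp (x k + y k)) ≤ Real.log (Z * Real.exp (μ + 4 * B ^ 2)) :=
        Real.log_le_log (sum_exp_pos hK _) hle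
    _ = Real.log Z + μ + 4 * B ^ 2 := by
        rw [Real.log_mul hZ0.ne' (Real.exp_pos _).ne', Real.log_exp]; ring

lemma BddMeas.log_sum_exp {Ω : Type*} {m : MeasurableSpace Ω} (hK : K.Nonempty)
    {x : κ → Ω → ℝ} (hx : ∀ k ∈ K, BddMeas m (x k)) :
    BddMeas m (fun ω => Real.log (∑ k ∈ K, Real.exp (x k ω))) := by
  obtain ⟨-, C, hC⟩ := BddMeas.sum fun k hk => (hx k hk).abs
  have hb : ∀ ω, ∀ k ∈ K, |x k ω| ≤ C := fun ω k hk =>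
    (Finset.single_le_sum (f := fun k => |x k ω|) (fun _ _ => abs_nonneg _) hk).trans
      ((le_abs_self _).trans (hC ω))
  refine ⟨(BddMeas.sum fun k hk => (hx k hk).exp).1.log, Real.log K.card + C, fun ω => ?_⟩
  have hc : (1 : ℝ) ≤ K.card := by exact_mod_cast hK.card_pos
  have hl := Real.log_nonneg hc
  have hC0 : 0 ≤ C := by
    obtain ⟨k, hk⟩ := hK
    exact (abs_nonneg _).trans (hb ω k hk)
  refine abs_le.2 ⟨?_, ?_⟩
  · obtain ⟨k, hk⟩ := hK
    have : Real.log (Real.exp (x k ω)) ≤ Real.log (∑ k ∈ K, Real.exp (x k ω)) :=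
      Real.log_le_log (Real.exp_pos _)
        (Finset.single_le_sum (f := fun k => Real.exp (x k ω)) (fun _ _ => (Real.exp_pos _).le) hk)
    rw [Real.log_exp] at this
    have := (abs_le.1 (hb ω k hk)).1
    linarith
  · have : ∑ k ∈ K, Real.exp (x k ω) ≤ K.card * Real.exp C := by
      refine (Finset.sum_le_card_nsmul K _ (Real.exp C) fun k hk => ?_).trans_eq (by simp)
      exact Real.exp_le_exp.2 ((le_abs_self _).trans (hb ω k hk))
    refine (Real.log_le_log (sum_exp_pos hK _) this).trans_eq ?_
    rw [Real.log_mul (by linarith) (Real.exp_pos _).ne', Real.log_exp]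

end

section

variable {ι : Type*}

/-- The family `(s x_f)` indexed by `f ∈ F` and a sign `s`. -/
def signed (x : ι → ℝ) (p : ι × ℝ) : ℝ := p.2 * x p.1

/-- The index set of the signed family. -/
def signedSet (F : Finset ι) : Finset (ι × ℝ) := F ×ˢ {1, -1}

lemma signedSet_nonempty {F : Finset ι} (hF : F.Nonempty) : (signedSet F).Nonempty :=
  hF.product ⟨1, by simp⟩

lemma card_signedSet (F : Finset ι) : ((signedSet F).card : ℝ) = 2 * F.card := by
  have : ({1, -1} : Finset ℝ).card = 2 := Finset.card_pair (by norm_num)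
  rw [signedSet, Finset.card_product, this]
  push_cast
  ring

lemma abs_signed {F : Finset ι} {p : ι × ℝ} (hp : p ∈ signedSet F) (x : ι → ℝ) :
    |signed x p| = |x p.1| := by
  have : p.2 = 1 ∨ p.2 = -1 := by simpa using (Finset.mem_product.1 hp).2
  rcases this with h | h <;> simp [signed, h]

lemma fst_mem {F : Finset ι} {p : ι × ℝ} (hp : p ∈ signedSet F) : p.1 ∈ F :=
  (Finset.mem_product.1 hp).1

lemma sup'_abs_le_log_sum_exp {F : Finset ι} (hF : F.Nonempty) (x : ι → ℝ) :
    F.sup' hF (fun f => |x f|) ≤ Real.log (∑ p ∈ signedSet F, Real.exp (signed x p)) := by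
  refine Finset.sup'_le hF _ fun f hf => ?_
  have key : ∀ s : ℝ, s = 1 ∨ s = -1 →
      s * x f ≤ Real.log (∑ p ∈ signedSet F, Real.exp (signed x p)) := by
    intro s hs
    have hmem : (f, s) ∈ signedSet F := Finset.mem_product.2 ⟨hf, by simpa using hs⟩
    have := Real.log_le_log (Real.exp_pos _)
        (Finset.single_le_sum (f := fun p => Real.exp (signed x p))
          (fun _ _ => (Real.exp_pos _).le) hmem)
    rwa [Real.log_exp] at this
  exact abs_le'.2 ⟨by simpa using key 1 (Or.inl rfl), by simpa using key (-1) (Or.inr rfl)⟩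

end

/-! ### Maximal inequalities for martingale differences and for independent variables -/

section

variable {Ω ι κ : Type*} {mΩ : MeasurableSpace Ω} {P : Measure Ω} [IsProbabilityMeasure P]

/-- The potential along a martingale: the linear part of each step has mean zero, since the softmax
weights depend on the preceding steps only. -/
lemma integral_log_sum_exp_le_of_martingaleDifference {K : Finset κ} (hK : K.Nonempty)
    {𝒢 : ℕ → MeasurableSpace Ω} (h𝒢 : ∀ b, 𝒢 b ≤ mΩ) (hmono : Monotone 𝒢)
    {Y : ℕ → κ → Ω → ℝ} (hY : ∀ b, ∀ k ∈ K, BddMeas (𝒢 (b + 1)) (Y b k))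
    {B : ℕ → Ω → ℝ} (hB : ∀ b, BddMeas mΩ (B b))
    (hYB : ∀ b, ∀ k ∈ K, ∀ ω, |Y b k ω| ≤ B b ω)
    (horth : ∀ b, ∀ k ∈ K, ∀ ψ, BddMeas (𝒢 b) ψ → ∫ ω, ψ ω * Y b k ω ∂P = 0) (N : ℕ) :
    ∫ ω, Real.log (∑ k ∈ K, Real.exp (∑ b ∈ Finset.range N, Y b k ω)) ∂P ≤
      Real.log K.card + 4 * ∑ b ∈ Finset.range N, ∫ ω, B b ω ^ 2 ∂P := by
  have hS : ∀ N, ∀ k ∈ K, BddMeas (𝒢 N) (fun ω => ∑ b ∈ Finset.range N, Y b k ω) :=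
    fun N k hk => BddMeas.sum fun b hb =>
      (hY b k hk).mono (hmono (Nat.succ_le_of_lt (Finset.mem_range.1 hb)))
  induction N with
  | zero => simp
  | succ N ih =>
    set x : κ → Ω → ℝ := fun k ω => ∑ b ∈ Finset.range N, Y b k ω with hx
    have hsm : ∀ k ∈ K, BddMeas (𝒢 N) (fun ω => softmax K (fun l => x l ω) k) := by
      intro k hk
      refine ⟨?_, 1, fun ω => ?_⟩
      · exact (hS N k hk).exp.1.div (BddMeas.sum fun l hl => (hS N l hl).exp).1
      · rw [abs_of_nonneg (softmax_nonneg _ _)]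
        exact softmax_le_one hk _
    have i1 : BddMeas mΩ (fun ω => Real.log (∑ k ∈ K, Real.exp (x k ω))) :=
      BddMeas.log_sum_exp hK fun k hk => (hS N k hk).mono (h𝒢 N)
    have i2 : ∀ k ∈ K, BddMeas mΩ (fun ω => softmax K (fun l => x l ω) k * Y N k ω) :=
      fun k hk => ((hsm k hk).mono (h𝒢 N)).mul ((hY N k hk).mono (h𝒢 _))
    have i3 := (hB N).pow_two.const_mul 4
    have i4 := BddMeas.log_sum_exp hK fun k hk => (hS (N + 1) k hk).mono (h𝒢 (N + 1))
    calc ∫ ω, Real.log (∑ k ∈ K, Real.exp (∑ b ∈ Finset.range (N + 1), Y b k ω)) ∂P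
        ≤ ∫ ω, (Real.log (∑ k ∈ K, Real.exp (x k ω))
            + ∑ k ∈ K, softmax K (fun l => x l ω) k * Y N k ω + 4 * B N ω ^ 2) ∂P := by
          refine integral_mono i4.integrable
            ((i1.add (BddMeas.sum i2)).add i3).integrable fun ω => ?_
          simp only [Finset.sum_range_succ]
          exact log_sum_exp_add_le hK (fun k => x k ω) (fun k => Y N k ω)
            fun k hk => hYB N k hk ω
      _ = ∫ ω, Real.log (∑ k ∈ K, Real.exp (x k ω)) ∂P + 4 * ∫ ω, B N ω ^ 2 ∂P := by
          rw [integral_add (i1.add (BddMeas.sum i2)).integrable i3.integrable,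
            integral_add i1.integrable (BddMeas.sum i2).integrable,
            integral_finsetSum _ fun k hk => (i2 k hk).integrable, integral_const_mul,
            Finset.sum_eq_zero fun k hk => horth N k hk _ (hsm k hk), add_zero]
      _ ≤ _ := by
          rw [Finset.sum_range_succ]
          linarith

/-- A maximal inequality for martingale differences with values in `ℝ^F`, in which the dimension
enters only through its logarithm. The condition `horth` says that `Y b` is a martingale difference
with respect to `𝒢`. -/
theorem integral_sup_abs_sum_le_of_martingaleDifference {F : Finset ι} (hF : F.Nonempty)
    {𝒢 : ℕ → MeasurableSpace Ω} (h𝒢 : ∀ b, 𝒢 b ≤ mΩ) (hmono : Monotone 𝒢)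
    {Y : ℕ → ι → Ω → ℝ} (hY : ∀ b, ∀ f ∈ F, BddMeas (𝒢 (b + 1)) (Y b f))
    (horth : ∀ b, ∀ f ∈ F, ∀ ψ, BddMeas (𝒢 b) ψ → ∫ ω, ψ ω * Y b f ω ∂P = 0) (N : ℕ)
    {v : ℝ} (hv0 : 0 ≤ v)
    (hv : ∑ b ∈ Finset.range N, ∫ ω, (F.sup' hF fun f => |Y b f ω|) ^ 2 ∂P ≤ v ^ 2) :
    ∫ ω, F.sup' hF (fun f => |∑ b ∈ Finset.range N, Y b f ω|) ∂P ≤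
      5 * Real.sqrt (Real.log (2 * F.card)) * v := by
  set L := Real.log (2 * F.card) with hL
  have hL0 : 0 < L := Real.log_pos (by
    have : (1 : ℝ) ≤ F.card := by exact_mod_cast hF.card_pos
    linarith)
  set B : ℕ → Ω → ℝ := fun b ω => F.sup' hF fun f => |Y b f ω| with hBdef
  have hB : ∀ b, BddMeas mΩ (B b) := fun b =>
    BddMeas.sup' hF fun f hf => ((hY b f hf).mono (h𝒢 _)).abs
  -- the bound for a fixed scale of the potential
  have key : ∀ lam : ℝ, 0 < lam →
      ∫ ω, F.sup' hF (fun f => |∑ b ∈ Finset.range N, Y b f ω|) ∂P ≤ L / lam + 4 * lam * v ^ 2 := by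
    intro lam hlam
    have hS : ∀ f ∈ F, BddMeas mΩ (fun ω => ∑ b ∈ Finset.range N, Y b f ω) := fun f hf =>
      BddMeas.sum fun b _ => (hY b f hf).mono (h𝒢 _)
    have h := integral_log_sum_exp_le_of_martingaleDifference (P := P) (signedSet_nonempty hF)
      h𝒢 hmono (Y := fun b p ω => signed (fun f => lam * Y b f ω) p) (B := fun b ω => lam * B b ω)
      (fun b p hp => ((hY b p.1 (fst_mem hp)).const_mul lam).const_mul p.2)
      (fun b => (hB b).const_mul lam)
      (fun b p hp ω => by
        rw [abs_signed hp, abs_mul, abs_of_pos hlam]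
        exact mul_le_mul_of_nonneg_left
          (Finset.le_sup' (fun f => |Y b f ω|) (fst_mem hp)) hlam.le)
      (fun b p hp ψ hψ => by
        have : (fun ω => ψ ω * signed (fun f => lam * Y b f ω) p)
            = fun ω => (p.2 * lam) * (ψ ω * Y b p.1 ω) := by
          funext ω; simp only [signed]; ring
        rw [this, integral_const_mul, horth b p.1 (fst_mem hp) ψ hψ, mul_zero]) N
    rw [card_signedSet, ← hL] at h
    have e : ∀ ω p, ∑ b ∈ Finset.range N, signed (fun f => lam * Y b f ω) p
        = signed (fun f => lam * ∑ b ∈ Finset.range N, Y b f ω) p := fun ω p => by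
      simp only [signed, Finset.mul_sum]
    simp only [e, mul_pow, integral_const_mul, ← Finset.mul_sum] at h
    have hlow : lam * ∫ ω, F.sup' hF (fun f => |∑ b ∈ Finset.range N, Y b f ω|) ∂P ≤
        ∫ ω, Real.log (∑ p ∈ signedSet F,
          Real.exp (signed (fun f => lam * ∑ b ∈ Finset.range N, Y b f ω) p)) ∂P := by
      rw [← integral_const_mul]
      refine integral_mono ((BddMeas.sup' hF fun f hf => (hS f hf).abs).const_mul lam).integrable
        (BddMeas.log_sum_exp (signedSet_nonempty hF) fun p hp =>
          ((hS p.1 (fst_mem hp)).const_mul lam).const_mul p.2).integrable fun ω => ?_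
      refine le_trans (le_of_eq ?_) (sup'_abs_le_log_sum_exp hF _)
      simp only [abs_mul, abs_of_pos hlam]
      exact (Finset.mul₀_sup' hlam.le _ _ hF)
    have h4 : 4 * (lam ^ 2 * ∑ b ∈ Finset.range N, ∫ ω, B b ω ^ 2 ∂P) ≤ 4 * (lam ^ 2 * v ^ 2) := by
      gcongr
    have : L / lam + 4 * lam * v ^ 2 = (L + 4 * (lam ^ 2 * v ^ 2)) / lam := by
      field_simp
    rw [this, le_div_iff₀ hlam]
    linarith
  -- the optimal scale is `√L / v`; a multiple of `δ` is added to `v` to cover the case `v = 0`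
  have hs0 : 0 < Real.sqrt L := Real.sqrt_pos.2 hL0
  have hs2 : Real.sqrt L ^ 2 = L := Real.sq_sqrt hL0.le
  refine le_of_forall_pos_le_add fun δ hδ => ?_
  set u := v + δ / (5 * Real.sqrt L) with hu
  have hu0 : 0 < u := by positivity
  have hvu : v ≤ u := by rw [hu]; linarith [show 0 < δ / (5 * Real.sqrt L) by positivity]
  refine (key (Real.sqrt L / u) (by positivity)).trans ?_
  calc L / (Real.sqrt L / u) + 4 * (Real.sqrt L / u) * v ^ 2
      ≤ L / (Real.sqrt L / u) + 4 * (Real.sqrt L / u) * u ^ 2 := by gcongr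
    _ = 5 * Real.sqrt L * u := by
        nth_rw 1 [← hs2]
        field_simp
        ring
    _ = 5 * Real.sqrt L * v + δ := by
        rw [hu]; field_simp

lemma integral_exp_sum_le {𝒢 : ℕ → MeasurableSpace Ω} (h𝒢 : ∀ b, 𝒢 b ≤ mΩ) (hmono : Monotone 𝒢)
    {T : ℕ → Ω → ℝ} (hT : ∀ b, BddMeas (𝒢 (b + 1)) (T b)) (hT1 : ∀ b ω, |T b ω| ≤ 1)
    (hT0 : ∀ b, ∫ ω, T b ω ∂P = 0)
    (hind : ∀ b, Indep (𝒢 b) (MeasurableSpace.comap (T b) inferInstance) P) (N : ℕ) :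
    ∫ ω, Real.exp (∑ b ∈ Finset.range N, T b ω) ∂P ≤
      Real.exp (∑ b ∈ Finset.range N, ∫ ω, T b ω ^ 2 ∂P) := by
  have hS : ∀ N, BddMeas (𝒢 N) (fun ω => ∑ b ∈ Finset.range N, T b ω) :=
    fun N => BddMeas.sum fun b hb => (hT b).mono (hmono (Nat.succ_le_of_lt (Finset.mem_range.1 hb)))
  induction N with
  | zero => simp
  | succ N ih =>
    have hTN := (hT N).mono (h𝒢 _)
    have hfac : ∫ ω, Real.exp (∑ b ∈ Finset.range N, T b ω) * Real.exp (T N ω) ∂P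
        = (∫ ω, Real.exp (∑ b ∈ Finset.range N, T b ω) ∂P) * ∫ ω, Real.exp (T N ω) ∂P := by
      have hi : IndepFun (fun ω => Real.exp (∑ b ∈ Finset.range N, T b ω))
          (fun ω => Real.exp (T N ω)) P := by
        rw [IndepFun_iff_Indep]
        refine indep_of_indep_of_le_left (indep_of_indep_of_le_right (hind N) ?_) ?_
        · exact (Real.measurable_exp.comp (comap_measurable (T N))).comap_le
        · exact (hS N).exp.1.comap_le
      exact hi.integral_mul_eq_mul_integral
        (((hS N).exp.mono (h𝒢 N)).1.aestronglyMeasurable) hTN.exp.1.aestronglyMeasurable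
    have hone : ∫ ω, Real.exp (T N ω) ∂P ≤ Real.exp (∫ ω, T N ω ^ 2 ∂P) := by
      calc ∫ ω, Real.exp (T N ω) ∂P ≤ ∫ ω, (1 + T N ω + T N ω ^ 2) ∂P := by
            refine integral_mono hTN.exp.integrable
              (((BddMeas.const 1).add hTN).add hTN.pow_two).integrable fun ω => ?_
            have := (abs_le.1 (Real.abs_exp_sub_one_sub_id_le (hT1 N ω))).2
            simp only
            linarith
        _ = 1 + ∫ ω, T N ω ^ 2 ∂P := by
            rw [integral_add ((BddMeas.const 1).add hTN).integrable hTN.pow_two.integrable,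
              integral_add (integrable_const _) hTN.integrable, hT0 N]
            simp
        _ ≤ _ := by linarith [Real.add_one_le_exp (∫ ω, T N ω ^ 2 ∂P)]
    simp only [Finset.sum_range_succ, Real.exp_add]
    rw [hfac]
    exact mul_le_mul ih hone (integral_nonneg fun _ => (Real.exp_pos _).le) (Real.exp_pos _).le

/-- A maximal inequality of Bernstein type for sums of bounded centred random vectors, each of them
independent of the preceding ones. -/
theorem integral_sup_abs_sum_le_of_indep {F : Finset ι} (hF : F.Nonempty)
    {𝒢 : ℕ → MeasurableSpace Ω} (h𝒢 : ∀ b, 𝒢 b ≤ mΩ) (hmono : Monotone 𝒢)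
    {T : ℕ → ι → Ω → ℝ} (hT : ∀ b, ∀ f ∈ F, BddMeas (𝒢 (b + 1)) (T b f))
    {C : ℝ} (hC0 : 0 ≤ C) (hTC : ∀ b, ∀ f ∈ F, ∀ ω, |T b f ω| ≤ C)
    (hT0 : ∀ b, ∀ f ∈ F, ∫ ω, T b f ω ∂P = 0)
    (hind : ∀ b, ∀ f ∈ F, Indep (𝒢 b) (MeasurableSpace.comap (T b f) inferInstance) P) (N : ℕ)
    {v : ℝ} (hv0 : 0 ≤ v)
    (hv : ∀ f ∈ F, ∑ b ∈ Finset.range N, ∫ ω, T b f ω ^ 2 ∂P ≤ v ^ 2) :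
    ∫ ω, F.sup' hF (fun f => |∑ b ∈ Finset.range N, T b f ω|) ∂P ≤
      2 * Real.sqrt (Real.log (2 * F.card)) * v + C * Real.log (2 * F.card) := by
  set L := Real.log (2 * F.card) with hL
  have hF1 : (1 : ℝ) ≤ F.card := by exact_mod_cast hF.card_pos
  have hL0 : 0 < L := Real.log_pos (by linarith)
  have hS : ∀ f ∈ F, BddMeas mΩ (fun ω => ∑ b ∈ Finset.range N, T b f ω) := fun f hf =>
    BddMeas.sum fun b _ => (hT b f hf).mono (h𝒢 _)
  have key : ∀ lam : ℝ, 0 < lam → lam * C ≤ 1 →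
      ∫ ω, F.sup' hF (fun f => |∑ b ∈ Finset.range N, T b f ω|) ∂P ≤ L / lam + lam * v ^ 2 := by
    intro lam hlam hlC
    set S : Ω → ι × ℝ → ℝ := fun ω p => signed (fun f => lam * ∑ b ∈ Finset.range N, T b f ω) p
      with hSdef
    have hSb : ∀ p ∈ signedSet F, BddMeas mΩ (fun ω => S ω p) := fun p hp =>
      ((hS p.1 (fst_mem hp)).const_mul lam).const_mul p.2
    have hexp : ∀ p ∈ signedSet F, ∫ ω, Real.exp (S ω p) ∂P ≤ Real.exp (lam ^ 2 * v ^ 2) := by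
      intro p hp
      have hf := fst_mem hp
      have hp2 : p.2 = 1 ∨ p.2 = -1 := by simpa using (Finset.mem_product.1 hp).2
      have hp2' : p.2 ^ 2 = 1 := by rcases hp2 with h | h <;> simp [h]
      have h := integral_exp_sum_le (P := P) h𝒢 hmono
        (T := fun b ω => signed (fun f => lam * T b f ω) p)
        (fun b => ((hT b p.1 hf).const_mul lam).const_mul p.2)
        (fun b ω => by
          rw [abs_signed hp, abs_mul, abs_of_pos hlam]
          exact (mul_le_mul_of_nonneg_left (hTC b p.1 hf ω) hlam.le).trans hlC)
        (fun b => by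
          simp only [signed, integral_const_mul, hT0 b p.1 hf, mul_zero])
        (fun b => by
          refine indep_of_indep_of_le_right (hind b p.1 hf) ?_
          exact (((comap_measurable (T b p.1)).const_mul lam).const_mul p.2).comap_le) N
      have e : ∀ ω, ∑ b ∈ Finset.range N, signed (fun f => lam * T b f ω) p = S ω p := fun ω => by
        simp only [hSdef, signed, Finset.mul_sum]
      simp only [e] at h
      refine h.trans (Real.exp_le_exp.2 ?_)
      simp only [signed, mul_pow, hp2', one_mul, integral_const_mul, ← Finset.mul_sum]
      exact mul_le_mul_of_nonneg_left (hv p.1 hf) (sq_nonneg _)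
    set c := (2 * (F.card : ℝ)) * Real.exp (lam ^ 2 * v ^ 2) with hc
    have hc0 : 0 < c := by positivity
    have hZ : BddMeas mΩ (fun ω => ∑ p ∈ signedSet F, Real.exp (S ω p)) :=
      BddMeas.sum fun p hp => (hSb p hp).exp
    have hZc : ∫ ω, ∑ p ∈ signedSet F, Real.exp (S ω p) ∂P ≤ c := by
      rw [integral_finsetSum _ fun p hp => (hSb p hp).exp.integrable]
      refine (Finset.sum_le_card_nsmul _ _ _ hexp).trans_eq ?_
      rw [nsmul_eq_mul, card_signedSet]
    have hup : lam * ∫ ω, F.sup' hF (fun f => |∑ b ∈ Finset.range N, T b f ω|) ∂P ≤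
        ∫ ω, (Real.log c + (c⁻¹ * (∑ p ∈ signedSet F, Real.exp (S ω p)) - 1)) ∂P := by
      rw [← integral_const_mul]
      refine integral_mono ((BddMeas.sup' hF fun f hf => (hS f hf).abs).const_mul lam).integrable
        ((BddMeas.const _).add ((hZ.const_mul _).sub (BddMeas.const 1))).integrable fun ω => ?_
      have h1 : lam * F.sup' hF (fun f => |∑ b ∈ Finset.range N, T b f ω|)
          ≤ Real.log (∑ p ∈ signedSet F, Real.exp (S ω p)) := by
        refine le_trans (le_of_eq ?_) (sup'_abs_le_log_sum_exp hF _)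
        simp only [abs_mul, abs_of_pos hlam]
        exact (Finset.mul₀_sup' hlam.le _ _ hF)
      -- concavity of the logarithm in the form of the tangent at `c`
      have hZ0 : 0 < ∑ p ∈ signedSet F, Real.exp (S ω p) := sum_exp_pos (signedSet_nonempty hF) _
      have h2 := Real.log_le_sub_one_of_pos (mul_pos (inv_pos.2 hc0) hZ0)
      rw [Real.log_mul (inv_pos.2 hc0).ne' hZ0.ne', Real.log_inv] at h2
      simp only
      linarith
    rw [integral_add (integrable_const _) ((hZ.const_mul _).sub (BddMeas.const 1)).integrable,
      integral_sub (hZ.const_mul _).integrable (integrable_const _), integral_const_mul] at hup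
    simp only [integral_const, probReal_univ, one_smul] at hup
    have h3 : c⁻¹ * ∫ ω, ∑ p ∈ signedSet F, Real.exp (S ω p) ∂P ≤ 1 := by
      rw [inv_mul_le_iff₀ hc0, mul_one]
      exact hZc
    have h4 : Real.log c = L + lam ^ 2 * v ^ 2 := by
      rw [hc, Real.log_mul (by positivity) (Real.exp_pos _).ne', Real.log_exp]
    have : L / lam + lam * v ^ 2 = (L + lam ^ 2 * v ^ 2) / lam := by
      field_simp
    rw [this, le_div_iff₀ hlam]
    linarith
  -- the scale is the inverse of `C + v / √L`, where the first term ensures `lam * C ≤ 1` and the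
  -- second balances the bound; a multiple of `δ` is added to cover the case `C = v = 0`
  have hs0 : 0 < Real.sqrt L := Real.sqrt_pos.2 hL0
  refine le_of_forall_pos_le_add fun δ hδ => ?_
  set D := C + v / Real.sqrt L + δ / L with hD
  have hD0 : 0 < D := by positivity
  have hvD : v ≤ Real.sqrt L * D := by
    have : Real.sqrt L * D = v + Real.sqrt L * (C + δ / L) := by
      rw [hD]; field_simp; ring
    rw [this]
    have : 0 ≤ Real.sqrt L * (C + δ / L) := by positivity
    linarith
  refine (key D⁻¹ (inv_pos.2 hD0) ?_).trans ?_
  · rw [inv_mul_le_iff₀ hD0, mul_one, hD]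
    have : 0 ≤ v / Real.sqrt L + δ / L := by positivity
    linarith
  · have h1 : L / D⁻¹ = C * L + Real.sqrt L * v + δ := by
      have h5 : v / Real.sqrt L * L = Real.sqrt L * v := by
        rw [div_mul_eq_mul_div, mul_div_assoc, Real.div_sqrt, mul_comm]
      rw [div_inv_eq_mul, hD, mul_add, mul_add, mul_comm L, mul_comm L, h5,
        mul_div_cancel₀ _ hL0.ne']
    have h2 : D⁻¹ * v ^ 2 ≤ Real.sqrt L * v := by
      rw [inv_mul_le_iff₀ hD0]
      nlinarith
    linarith

end

/-! ### Integrals of bounded functions -/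

section

variable {α β : Type*} [MeasurableSpace α] [MeasurableSpace β] {μ : Measure β}
  [IsProbabilityMeasure μ]

lemma abs_integral_le_of_abs_le {f : β → ℝ} {C : ℝ} (h : ∀ x, |f x| ≤ C) : |∫ x, f x ∂μ| ≤ C := by
  have := norm_integral_le_of_norm_le_const (μ := μ) (f := f) (Filter.Eventually.of_forall h)
  simpa using this

lemma abs_integral_le_integral_of_abs_le {f g : β → ℝ} (hg : BddMeas inferInstance g)
    (h : ∀ x, |f x| ≤ g x) : |∫ x, f x ∂μ| ≤ ∫ x, g x ∂μ := by
  rw [← Real.norm_eq_abs]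
  exact norm_integral_le_of_norm_le hg.integrable (Filter.Eventually.of_forall h)

lemma BddMeas.integral_prod {h : α → β → ℝ} (hh : BddMeas inferInstance (Function.uncurry h)) :
    BddMeas inferInstance fun x => ∫ y, h x y ∂μ := by
  refine ⟨(hh.1.stronglyMeasurable.integral_prod_right (f := h)).measurable, ?_⟩
  exact hh.2.imp fun C hC x => abs_integral_le_of_abs_le fun y => hC (x, y)

lemma sq_integral_le {f : β → ℝ} (hf : BddMeas inferInstance f) :
    (∫ x, f x ∂μ) ^ 2 ≤ ∫ x, f x ^ 2 ∂μ := by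
  set c := ∫ x, f x ∂μ with hc
  have h : ∫ x, (2 * c * f x - c ^ 2) ∂μ ≤ ∫ x, f x ^ 2 ∂μ :=
    integral_mono ((hf.const_mul _).sub (BddMeas.const _)).integrable hf.pow_two.integrable
      fun x => by simp only; nlinarith [sq_nonneg (f x - c)]
  rw [integral_sub (hf.const_mul _).integrable (integrable_const _), integral_const_mul, ← hc] at h
  simp only [integral_const, probReal_univ, one_smul] at h
  linarith

end

/-! ### The innovations and the past -/

section

variable {Ω : Type*} {mΩ : MeasurableSpace Ω} {P : Measure Ω} {d' : ℕ}
  {ε ε' : ℤ → Ω → Fin d' → ℝ}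

/-- The `σ`-algebra generated by the innovations `ε_k` with `k ∈ A`. -/
abbrev innov (ε : ℤ → Ω → Fin d' → ℝ) (A : Set ℤ) : MeasurableSpace Ω :=
  ⨆ k ∈ A, MeasurableSpace.comap (ε k) inferInstance

lemma innov_mono {A B : Set ℤ} (h : A ⊆ B) : innov ε A ≤ innov ε B :=
  biSup_mono h

lemma innov_le (h : IsInnovation P ε ε') (A : Set ℤ) : innov ε A ≤ mΩ :=
  iSup₂_le fun k _ => (h.measurable k).comap_le

lemma measurable_innov {A : Set ℤ} {k : ℤ} (hk : k ∈ A) : Measurable[innov ε A] (ε k) :=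
  Measurable.mono (comap_measurable (ε k)) (le_iSup₂_of_le k hk le_rfl) le_rfl

lemma indep_innov (h : IsInnovation P ε ε') {A B : Set ℤ} (hAB : Disjoint A B) :
    Indep (innov ε A) (innov ε B) P :=
  indep_iSup_of_disjoint (fun k => (h.measurable k).comap_le) h.indep.iIndep hAB

lemma measurable_past {t : ℤ} : Measurable[innov ε (Set.Iic t)] (past ε t) := by
  refine @measurable_pi_lambda _ _ _ (innov ε (Set.Iic t)) _ _ fun k => measurable_innov ?_
  simp

lemma measurable_past' (h : IsInnovation P ε ε') (t : ℤ) : Measurable (past ε t) :=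
  measurable_past.mono (innov_le h _) le_rfl

lemma bddMeas_past {G : (ℕ → Fin d' → ℝ) → ℝ} {M : ℝ} (hε : IsInnovation P ε ε')
    (hG : Measurable G) (hGM : ∀ x, |G x| ≤ M) (t : ℤ) :
    BddMeas mΩ fun ω => G (past ε t ω) :=
  ⟨hG.comp (measurable_past' hε t), M, fun _ => hGM _⟩

/-- The common law of the pasts `(ε_t, ε_{t-1}, …)`. -/
def pastLaw (P : Measure Ω) (ε : ℤ → Ω → Fin d' → ℝ) : Measure (ℕ → Fin d' → ℝ) :=
  P.map (past ε 0)

variable [IsProbabilityMeasure P]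

lemma isProbabilityMeasure_pastLaw (h : IsInnovation P ε ε') :
    IsProbabilityMeasure (pastLaw P ε) :=
  Measure.isProbabilityMeasure_map (measurable_past' h 0).aemeasurable

lemma map_past (h : IsInnovation P ε ε') (t : ℤ) : P.map (past ε t) = pastLaw P ε := by
  have key : ∀ t : ℤ, P.map (past ε t) = Measure.infinitePi fun _ : ℕ => P.map (ε 0) := by
    intro t
    have hi : iIndepFun (fun k : ℕ => ε (t - k)) P :=
      h.indep.precomp (g := fun k : ℕ => t - (k : ℤ)) fun a b hab => by
        simpa using hab
    have := (iIndepFun_iff_map_fun_eq_infinitePi_map fun k : ℕ => h.measurable (t - k)).1 hi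
    refine this.trans ?_
    congr 1
    funext k
    exact (h.ident (t - k) 0).map_eq
  rw [key, pastLaw, key]

/-- Independence as a Fubini theorem: `V` may be integrated out separately. -/
lemma integral_indep {α β : Type*} [MeasurableSpace α] [MeasurableSpace β] {U : Ω → α} {V : Ω → β}
    (hUV : IndepFun U V P) (hU : Measurable U) (hV : Measurable V) {h : α → β → ℝ}
    (hm : Measurable (Function.uncurry h)) {C : ℝ} (hb : ∀ ω, ∀ ω', |h (U ω) (V ω')| ≤ C) :
    ∫ ω, h (U ω) (V ω) ∂P = ∫ ω, ∫ y, h (U ω) y ∂(P.map V) ∂P := by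
  have hmap := (indepFun_iff_map_prod_eq_prod_map_map hU.aemeasurable hV.aemeasurable).1 hUV
  have : IsProbabilityMeasure (P.map V) := Measure.isProbabilityMeasure_map hV.aemeasurable
  have : IsProbabilityMeasure (P.map U) := Measure.isProbabilityMeasure_map hU.aemeasurable
  have hint : Integrable (Function.uncurry h) ((P.map U).prod (P.map V)) := by
    rw [← hmap]
    refine (integrable_map_measure hm.aestronglyMeasurable
      (hU.prodMk hV).aemeasurable).2 ?_
    exact Integrable.of_bound (hm.comp (hU.prodMk hV)).aestronglyMeasurable C
      (Filter.Eventually.of_forall fun ω => hb ω ω)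
  calc ∫ ω, h (U ω) (V ω) ∂P = ∫ z, Function.uncurry h z ∂(P.map fun ω => (U ω, V ω)) :=
        (integral_map (hU.prodMk hV).aemeasurable hm.aestronglyMeasurable).symm
    _ = ∫ x, ∫ y, h x y ∂(P.map V) ∂(P.map U) := by
        rw [hmap, integral_prod _ hint]
        rfl
    _ = ∫ ω, ∫ y, h (U ω) y ∂(P.map V) ∂P :=
        integral_map hU.aemeasurable
          (hm.stronglyMeasurable.integral_prod_right (f := h)).aestronglyMeasurable

/-- A version of `integral_indep` in terms of the innovations on which `U` and `V` depend. -/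
lemma integral_innov {α β : Type*} [MeasurableSpace α] [MeasurableSpace β]
    (hε : IsInnovation P ε ε')
    {A B : Set ℤ} (hAB : Disjoint A B) {U : Ω → α} {V : Ω → β} (hU : Measurable[innov ε A] U)
    (hV : Measurable[innov ε B] V) {h : α → β → ℝ}
    (hm : Measurable (Function.uncurry h)) {C : ℝ} (hb : ∀ ω, ∀ ω', |h (U ω) (V ω')| ≤ C) :
    ∫ ω, h (U ω) (V ω) ∂P = ∫ ω, ∫ y, h (U ω) y ∂(P.map V) ∂P := by
  refine integral_indep ?_ (hU.mono (innov_le hε A) le_rfl) (hV.mono (innov_le hε B) le_rfl) hm hb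
  rw [IndepFun_iff_Indep]
  exact indep_of_indep_of_le_left (indep_of_indep_of_le_right (indep_innov hε hAB) hV.comap_le)
    hU.comap_le

/-! ### Approximation by functions of finitely many innovations -/

/-- The sequence `(x₀, …, x_{m-1}, y₀, y₁, …)`. -/
def splice (m : ℕ) (x y : ℕ → Fin d' → ℝ) : ℕ → Fin d' → ℝ :=
  fun k => if k < m then x k else y (k - m)

lemma measurable_splice (m : ℕ) :
    Measurable (fun p : (ℕ → Fin d' → ℝ) × (ℕ → Fin d' → ℝ) => splice m p.1 p.2) := by
  refine measurable_pi_lambda _ fun k => ?_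
  by_cases hk : k < m
  · simp only [splice, hk, if_true]
    fun_prop
  · simp only [splice, hk, if_false]
    fun_prop

lemma splice_past (t : ℤ) (m : ℕ) (ω : Ω) :
    splice m (past ε t ω) (past ε (t - m) ω) = past ε t ω := by
  funext k
  unfold splice past
  split_ifs with hk
  · rfl
  · congr 1
    push_cast [Nat.cast_sub (not_lt.1 hk)]
    ring

lemma splice_splice_zero (m : ℕ) (x y : ℕ → Fin d' → ℝ) :
    splice m (splice m x 0) y = splice m x y := by
  funext k
  by_cases hk : k < m <;> simp [splice, hk]

lemma measurable_splice_past (t : ℤ) (m : ℕ) :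
    Measurable[innov ε (Set.Ioc (t - m) t)] fun ω => splice m (past ε t ω) 0 := by
  refine @measurable_pi_lambda _ _ _ (innov ε (Set.Ioc (t - m) t)) _ _ fun k => ?_
  by_cases hk : k < m
  · simp only [splice, hk, if_true]
    refine measurable_innov ?_
    simp only [Set.mem_Ioc]
    omega
  · simp only [splice, hk, if_false]
    exact measurable_const

/-- For `W = G(ε_t, ε_{t-1}, …)` the conditional expectation `𝔼[W | ε_t, …, ε_{t-m+1}]`, in which
the older innovations are integrated out explicitly. -/
def approx (P : Measure Ω) (ε : ℤ → Ω → Fin d' → ℝ) (G : (ℕ → Fin d' → ℝ) → ℝ) (t : ℤ) (m : ℕ)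
    (ω : Ω) : ℝ :=
  ∫ y, G (splice m (past ε t ω) y) ∂(pastLaw P ε)

variable {G : (ℕ → Fin d' → ℝ) → ℝ} {M : ℝ}

lemma abs_approx_le (hε : IsInnovation P ε ε') (hGM : ∀ x, |G x| ≤ M) (t : ℤ) (m : ℕ) (ω : Ω) :
    |approx P ε G t m ω| ≤ M := by
  have := isProbabilityMeasure_pastLaw hε
  exact abs_integral_le_of_abs_le fun y => hGM (splice m (past ε t ω) y)

lemma bddMeas_approx (hε : IsInnovation P ε ε') (hG : Measurable G) (hGM : ∀ x, |G x| ≤ M)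
    (t : ℤ) (m : ℕ) : BddMeas (innov ε (Set.Ioc (t - m) t)) (approx P ε G t m) := by
  have := isProbabilityMeasure_pastLaw hε
  refine ⟨?_, M, abs_approx_le hε hGM t m⟩
  have h1 : Measurable fun x : ℕ → Fin d' → ℝ => ∫ y, G (splice m x y) ∂(pastLaw P ε) :=
    ((hG.comp (measurable_splice m)).stronglyMeasurable.integral_prod_right
      (f := fun x y => G (splice m x y))).measurable
  have h2 := h1.comp (measurable_splice_past (ε := ε) t m)
  simp only [Function.comp_def, splice_splice_zero] at h2
  exact h2

/-- The approximation has the property of a conditional expectation, even with respect to all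
innovations younger than `t - m`. -/
lemma integral_mul_approx (hε : IsInnovation P ε ε') (hG : Measurable G) (hGM : ∀ x, |G x| ≤ M)
    (t : ℤ) (m : ℕ) {ψ : Ω → ℝ} (hψ : BddMeas (innov ε (Set.Ioi (t - m))) ψ) :
    ∫ ω, ψ ω * approx P ε G t m ω ∂P = ∫ ω, ψ ω * G (past ε t ω) ∂P := by
  have hdisj : Disjoint (Set.Ioi (t - (m : ℤ))) (Set.Iic (t - (m : ℤ))) :=
    Set.disjoint_left.2 fun a ha hb => absurd (Set.mem_Ioi.1 ha) (not_lt.2 hb)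
  have hU : Measurable[innov ε (Set.Ioi (t - (m : ℤ)))]
      fun ω => (ψ ω, splice m (past ε t ω) 0) := by
    refine Measurable.prodMk hψ.1 ((measurable_splice_past t m).mono (innov_mono ?_) le_rfl)
    exact fun a ha => ha.1
  obtain ⟨C, hC⟩ := hψ.2
  have hm : Measurable (Function.uncurry fun (p : ℝ × (ℕ → Fin d' → ℝ)) (y : ℕ → Fin d' → ℝ) =>
      p.1 * G (splice m p.2 y)) := by
    exact Measurable.mul (by fun_prop) (hG.comp ((measurable_splice m).comp
      ((measurable_snd.comp measurable_fst).prodMk measurable_snd)))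
  have h := integral_innov hε hdisj hU measurable_past hm (C := C * M) fun ω ω' => by
    rw [abs_mul]
    exact mul_le_mul (hC ω) (hGM _) (abs_nonneg _) ((abs_nonneg _).trans (hC ω))
  simp only [splice_splice_zero, splice_past, map_past hε, integral_const_mul] at h
  exact h.symm

lemma integral_approx (hε : IsInnovation P ε ε') (hG : Measurable G) (hGM : ∀ x, |G x| ≤ M)
    (t : ℤ) (m : ℕ) : ∫ ω, approx P ε G t m ω ∂P = ∫ ω, G (past ε t ω) ∂P := by
  simpa using integral_mul_approx hε hG hGM t m (BddMeas.const 1)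

lemma approx_zero (hε : IsInnovation P ε ε') (hG : Measurable G) (t : ℤ) (ω : Ω) :
    approx P ε G t 0 ω = ∫ ω', G (past ε t ω') ∂P := by
  have : ∀ y, splice 0 (past ε t ω) y = y := fun y => by
    funext k
    simp [splice]
  simp only [approx, this]
  rw [← map_past hε t, integral_map (measurable_past' hε t).aemeasurable hG.aestronglyMeasurable]

lemma Ioc_subset_Ioi_of_le {s s' t : ℤ} (h : s' ≤ s) : Set.Ioc s t ⊆ Set.Ioi s' :=
  fun _ ha => lt_of_le_of_lt h ha.1

lemma integral_approx_sq_le (hε : IsInnovation P ε ε') (hG : Measurable G)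
    (hGM : ∀ x, |G x| ≤ M) (t : ℤ) (m : ℕ) :
    ∫ ω, approx P ε G t m ω ^ 2 ∂P ≤ ∫ ω, G (past ε t ω) ^ 2 ∂P := by
  have ha := bddMeas_approx hε hG hGM t m
  have ha' := ha.mono (innov_le hε _)
  have hW := bddMeas_past hε hG hGM t
  have h1 : ∫ ω, approx P ε G t m ω ^ 2 ∂P = ∫ ω, approx P ε G t m ω * G (past ε t ω) ∂P := by
    rw [← integral_mul_approx hε hG hGM t m (ha.mono (innov_mono (Ioc_subset_Ioi_of_le le_rfl)))]
    simp only [sq]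
  have h2 : ∫ ω, approx P ε G t m ω * G (past ε t ω) ∂P ≤
      ∫ ω, ((1 / 2) * approx P ε G t m ω ^ 2 + (1 / 2) * G (past ε t ω) ^ 2) ∂P :=
    integral_mono (ha'.mul hW).integrable
      ((ha'.pow_two.const_mul _).add (hW.pow_two.const_mul _)).integrable fun ω => by
        simp only
        nlinarith [sq_nonneg (approx P ε G t m ω - G (past ε t ω))]
  rw [integral_add (ha'.pow_two.const_mul _).integrable (hW.pow_two.const_mul _).integrable,
    integral_const_mul, integral_const_mul] at h2
  linarith

/-- The increment of the approximation when one older innovation is taken into account. -/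
def incr (P : Measure Ω) (ε : ℤ → Ω → Fin d' → ℝ) (G : (ℕ → Fin d' → ℝ) → ℝ) (t : ℤ) (m : ℕ)
    (ω : Ω) : ℝ :=
  approx P ε G t (m + 1) ω - approx P ε G t m ω

lemma bddMeas_incr (hε : IsInnovation P ε ε') (hG : Measurable G) (hGM : ∀ x, |G x| ≤ M)
    (t : ℤ) (m : ℕ) : BddMeas (innov ε (Set.Ioc (t - m - 1) t)) (incr P ε G t m) := by
  have h1 := bddMeas_approx hε hG hGM t (m + 1)
  have h2 := bddMeas_approx hε hG hGM t m
  refine (h1.mono (innov_mono ?_)).sub (h2.mono (innov_mono ?_))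
  · push_cast
    exact Set.Ioc_subset_Ioc_left (by omega)
  · exact Set.Ioc_subset_Ioc_left (by omega)

/-- The increments are differences of a martingale for the reversed direction of time. -/
lemma integral_mul_incr (hε : IsInnovation P ε ε') (hG : Measurable G) (hGM : ∀ x, |G x| ≤ M)
    (t : ℤ) (m : ℕ) {ψ : Ω → ℝ} (hψ : BddMeas (innov ε (Set.Ioi (t - m))) ψ) :
    ∫ ω, ψ ω * incr P ε G t m ω ∂P = 0 := by
  have hψ' : BddMeas (innov ε (Set.Ioi (t - (m + 1 : ℕ)))) ψ :=
    hψ.mono (innov_mono (Set.Ioi_subset_Ioi (by push_cast; omega)))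
  have h1 := (bddMeas_approx hε hG hGM t (m + 1)).mono (innov_le hε _)
  have h2 := (bddMeas_approx hε hG hGM t m).mono (innov_le hε _)
  have h3 := hψ.mono (innov_le hε _)
  simp only [incr, mul_sub]
  rw [integral_sub (h3.mul h1).integrable (h3.mul h2).integrable,
    integral_mul_approx hε hG hGM t m hψ, integral_mul_approx hε hG hGM t (m + 1) hψ', sub_self]

lemma integral_incr_sq_le (hε : IsInnovation P ε ε') (hG : Measurable G)
    (hGM : ∀ x, |G x| ≤ M) (t : ℤ) (m : ℕ) :
    ∫ ω, incr P ε G t m ω ^ 2 ∂P ≤ ∫ ω, G (past ε t ω) ^ 2 ∂P := by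
  have h0 := bddMeas_approx hε hG hGM t m
  have h1 := (bddMeas_approx hε hG hGM t (m + 1)).mono (innov_le hε _)
  have h2 := h0.mono (innov_le hε _)
  have h3 := (bddMeas_incr hε hG hGM t m).mono (innov_le hε _)
  have horth := integral_mul_incr hε hG hGM t m
    (h0.mono (innov_mono (Ioc_subset_Ioi_of_le le_rfl)))
  refine le_trans ?_ (integral_approx_sq_le hε hG hGM t (m + 1))
  have : ∀ ω, approx P ε G t (m + 1) ω ^ 2 = incr P ε G t m ω ^ 2
      + 2 * (approx P ε G t m ω * incr P ε G t m ω) + approx P ε G t m ω ^ 2 := fun ω => by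
    simp only [incr]; ring
  simp only [this]
  rw [integral_add (h3.pow_two.add ((h2.mul h3).const_mul 2)).integrable h2.pow_two.integrable,
    integral_add h3.pow_two.integrable ((h2.mul h3).const_mul 2).integrable,
    integral_const_mul, horth]
  have : 0 ≤ ∫ ω, approx P ε G t m ω ^ 2 ∂P := integral_nonneg fun ω => sq_nonneg _
  linarith

/-! ### Increments and the dependence coefficients -/

/-- The sequence `(e, y₀, y₁, …)`. -/
def cons (e : Fin d' → ℝ) (y : ℕ → Fin d' → ℝ) : ℕ → Fin d' → ℝ := splice 1 (fun _ => e) y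

lemma measurable_cons :
    Measurable (fun p : (ℕ → Fin d' → ℝ) × (Fin d' → ℝ) => cons p.2 p.1) :=
  (measurable_splice 1).comp
    ((measurable_pi_lambda _ fun _ => measurable_snd).prodMk measurable_fst)

lemma cons_past (t : ℤ) (ω : Ω) : cons (ε t ω) (past ε (t - 1) ω) = past ε t ω := by
  funext k
  unfold cons splice past
  split_ifs with hk
  · simp [Nat.lt_one_iff.1 hk]
  · congr 1
    push_cast [Nat.cast_sub (not_lt.1 hk)]
    ring

/-- The first coordinate of the past may be integrated out separately. -/
lemma integral_pastLaw (hε : IsInnovation P ε ε') {φ : (ℕ → Fin d' → ℝ) → ℝ} (hφ : Measurable φ)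
    {C : ℝ} (hC : ∀ x, |φ x| ≤ C) :
    ∫ y, φ y ∂(pastLaw P ε) = ∫ y, ∫ e, φ (cons e y) ∂(P.map (ε 0)) ∂(pastLaw P ε) := by
  have : IsProbabilityMeasure (P.map (ε 0)) :=
    Measure.isProbabilityMeasure_map (hε.measurable 0).aemeasurable
  have hdisj : Disjoint (Set.Iic (0 - 1 : ℤ)) {0} := by simp
  have hm : Measurable (Function.uncurry fun (y : ℕ → Fin d' → ℝ) e => φ (cons e y)) :=
    hφ.comp measurable_cons
  have h := integral_innov hε hdisj measurable_past
    (measurable_innov (ε := ε) (Set.mem_singleton (0 : ℤ))) hm (C := C) fun _ _ => hC _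
  simp only [cons_past] at h
  rw [← map_past hε 0, integral_map (measurable_past' hε 0).aemeasurable hφ.aestronglyMeasurable, h,
    map_past hε 0, ← map_past hε (0 - 1), integral_map (measurable_past' hε _).aemeasurable]
  exact (hm.stronglyMeasurable.integral_prod_right
    (f := fun y e => φ (cons e y))).aestronglyMeasurable

lemma update_splice (m : ℕ) (x y : ℕ → Fin d' → ℝ) (e : Fin d' → ℝ) :
    Function.update (splice (m + 1) x y) m e = splice m x (cons e y) := by
  funext k
  rcases lt_trichotomy k m with hk | hk | hk
  · simp [splice, hk.ne, hk, Nat.lt_succ_of_lt hk]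
  · subst hk
    simp [splice, cons]
  · have h1 : ¬ k < m := by omega
    have h2 : ¬ k < m + 1 := by omega
    have h3 : ¬ k - m = 0 := by omega
    simp [splice, cons, hk.ne', h1, h2, h3, Nat.sub_sub]

/-- The increments are controlled by the effect of replacing one innovation: `incr` at `m` is a
conditional expectation of `W - W^{*(t-m)}`, so that Jensen's inequality applies. -/
lemma integral_sup_incr_sq_le {ι : Type*} {F : Finset ι} (hF : F.Nonempty)
    (hε : IsInnovation P ε ε') {G : ι → (ℕ → Fin d' → ℝ) → ℝ} (hG : ∀ f ∈ F, Measurable (G f))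
    (hGM : ∀ f ∈ F, ∀ x, |G f x| ≤ M) (t : ℤ) (m : ℕ) :
    ∫ ω, (F.sup' hF fun f => |incr P ε (G f) t m ω|) ^ 2 ∂P ≤
      ∫ ω, (F.sup' hF fun f => |G f (past ε t ω) - G f (pastStar ε ε' t m ω)|) ^ 2 ∂P := by
  set Q := pastLaw P ε with hQ
  set μ := P.map (ε 0) with hμ
  have hQp : IsProbabilityMeasure Q := isProbabilityMeasure_pastLaw hε
  have hμp : IsProbabilityMeasure μ :=
    Measure.isProbabilityMeasure_map (hε.measurable 0).aemeasurable
  -- `R x e y` is the effect of replacing the innovation of index `m` in `(x, y)` by `e`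
  set R : (ℕ → Fin d' → ℝ) → (Fin d' → ℝ) → (ℕ → Fin d' → ℝ) → ℝ := fun x e y =>
    F.sup' hF fun f => |G f (splice (m + 1) x y) - G f (splice m x (cons e y))| with hR
  have hbd : ∀ {α : Type _} [MeasurableSpace α]
      {a b : α → ℕ → Fin d' → ℝ} {e : α → Fin d' → ℝ}, Measurable a → Measurable b → Measurable e →
      BddMeas inferInstance fun z => R (a z) (e z) (b z) := by
    intro α _ a b e ha hb he
    refine BddMeas.sup' hF fun f hf => (BddMeas.sub ?_ ?_).abs
    · exact ⟨(hG f hf).comp ((measurable_splice (m + 1)).comp (ha.prodMk hb)), M,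
        fun _ => hGM f hf _⟩
    · exact ⟨(hG f hf).comp ((measurable_splice m).comp
        (ha.prodMk (measurable_cons.comp (hb.prodMk he)))), M, fun _ => hGM f hf _⟩
  have hM0 : 0 ≤ M := by
    obtain ⟨f, hf⟩ := hF
    exact (abs_nonneg _).trans (hGM f hf 0)
  have hR0 : ∀ x e y, 0 ≤ R x e y := fun x e y => by
    obtain ⟨f, hf⟩ := hF
    exact (abs_nonneg _).trans
      (Finset.le_sup' (fun f => |G f (splice (m + 1) x y) - G f (splice m x (cons e y))|) hf)
  have hRM : ∀ x e y, R x e y ^ 2 ≤ (2 * M) ^ 2 := fun x e y => by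
    refine pow_le_pow_left₀ (hR0 x e y) (Finset.sup'_le hF _ fun f hf => ?_) 2
    have h1 := abs_le.1 (hGM f hf (splice (m + 1) x y))
    have h2 := abs_le.1 (hGM f hf (splice m x (cons e y)))
    exact abs_le.2 ⟨by linarith, by linarith⟩
  have hRb : ∀ x, BddMeas inferInstance
      (Function.uncurry fun (y : ℕ → Fin d' → ℝ) (e : Fin d' → ℝ) => R x e y) := fun x =>
    hbd measurable_const measurable_fst measurable_snd
  have hRb' : BddMeas inferInstance (Function.uncurry
      fun (p : (ℕ → Fin d' → ℝ) × (ℕ → Fin d' → ℝ)) e => R p.1 e p.2 ^ 2) :=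
    (hbd (measurable_fst.comp measurable_fst) (measurable_snd.comp measurable_fst)
      measurable_snd).pow_two
  have hRb2 : BddMeas inferInstance (Function.uncurry
      fun (x y : ℕ → Fin d' → ℝ) => ∫ e, R x e y ^ 2 ∂μ) := hRb'.integral_prod
  have hbd1 : ∀ x, BddMeas inferInstance fun y => ∫ e, R x e y ∂μ := fun x =>
    (hRb x).integral_prod
  have hbd2 : ∀ x, BddMeas inferInstance fun y => ∫ e, R x e y ^ 2 ∂μ := fun x =>
    BddMeas.integral_prod (h := fun y e => R x e y ^ 2) (hRb x).pow_two
  have hbd0 : ∀ x y, BddMeas inferInstance fun e => R x e y := fun x y =>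
    hbd measurable_const measurable_const measurable_id
  -- the pointwise bound
  have hpt : ∀ ω, (F.sup' hF fun f => |incr P ε (G f) t m ω|) ^ 2 ≤
      ∫ y, ∫ e, R (past ε t ω) e y ^ 2 ∂μ ∂Q := by
    intro ω
    set x := past ε t ω with hx
    have hle : F.sup' hF (fun f => |incr P ε (G f) t m ω|) ≤ ∫ y, ∫ e, R x e y ∂μ ∂Q := by
      refine Finset.sup'_le hF _ fun f hf => ?_
      have hb1 : BddMeas inferInstance fun y => G f (splice (m + 1) x y) :=
        ⟨(hG f hf).comp ((measurable_splice (m + 1)).comp (measurable_const.prodMk measurable_id)),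
          M, fun _ => hGM f hf _⟩
      have hb2 : BddMeas inferInstance
          fun p : (ℕ → Fin d' → ℝ) × (Fin d' → ℝ) => G f (splice m x (cons p.2 p.1)) :=
        ⟨(hG f hf).comp ((measurable_splice m).comp (measurable_const.prodMk measurable_cons)),
          M, fun _ => hGM f hf _⟩
      have hb3 : BddMeas inferInstance fun y => ∫ e, G f (splice m x (cons e y)) ∂μ :=
        BddMeas.integral_prod (h := fun y e => G f (splice m x (cons e y))) hb2
      have hb4 : ∀ y, BddMeas inferInstance fun e => G f (splice m x (cons e y)) := fun y =>
        hb2.comp (measurable_const.prodMk measurable_id)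
      have e1 : incr P ε (G f) t m ω = ∫ y, ∫ e,
          (G f (splice (m + 1) x y) - G f (splice m x (cons e y))) ∂μ ∂Q := by
        have h1 : approx P ε (G f) t m ω = ∫ y, ∫ e, G f (splice m x (cons e y)) ∂μ ∂Q :=
          integral_pastLaw hε (φ := fun y => G f (splice m x y))
            ((hG f hf).comp ((measurable_splice m).comp (measurable_const.prodMk measurable_id)))
            (fun _ => hGM f hf _)
        rw [incr, h1, approx, ← integral_sub hb1.integrable hb3.integrable]
        refine integral_congr_ae (Filter.Eventually.of_forall fun y => ?_)
        simp only
        rw [integral_sub (integrable_const _) (hb4 y).integrable]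
        simp
      have hle1 : ∀ y e, |G f (splice (m + 1) x y) - G f (splice m x (cons e y))| ≤ R x e y :=
        fun y e => Finset.le_sup'
          (fun f => |G f (splice (m + 1) x y) - G f (splice m x (cons e y))|) hf
      rw [e1]
      exact abs_integral_le_integral_of_abs_le (hbd1 x) fun y =>
        abs_integral_le_integral_of_abs_le (hbd0 x y) fun e => hle1 y e
    have h0 : 0 ≤ F.sup' hF (fun f => |incr P ε (G f) t m ω|) := by
      obtain ⟨f, hf⟩ := hF
      exact (abs_nonneg _).trans (Finset.le_sup' (fun f => |incr P ε (G f) t m ω|) hf)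
    calc _ ≤ (∫ y, ∫ e, R x e y ∂μ ∂Q) ^ 2 := pow_le_pow_left₀ h0 hle 2
      _ ≤ ∫ y, (∫ e, R x e y ∂μ) ^ 2 ∂Q := sq_integral_le (hbd1 x)
      _ ≤ ∫ y, ∫ e, R x e y ^ 2 ∂μ ∂Q :=
          integral_mono (hbd1 x).pow_two.integrable (hbd2 x).integrable fun y =>
            sq_integral_le (hbd0 x y)
  -- the right-hand side is the mean of `R²` over independent arguments
  have hrhs : ∫ ω, (F.sup' hF fun f => |G f (past ε t ω) - G f (pastStar ε ε' t m ω)|) ^ 2 ∂P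
      = ∫ ω, ∫ y, ∫ e, R (past ε t ω) e y ^ 2 ∂μ ∂Q ∂P := by
    set s : ℤ := t - (m + 1 : ℕ) with hs
    set U : Ω → ℕ → Fin d' → ℝ := fun ω => splice (m + 1) (past ε t ω) 0 with hU
    have hRU : ∀ ω e y, R (U ω) e y = R (past ε t ω) e y := fun ω e y => by
      have h1 := splice_splice_zero (m + 1) (past ε t ω) y
      simp only [hR, ← update_splice, hU, h1]
    have hUm : Measurable[innov ε (Set.Ioc s t)] U := measurable_splice_past t (m + 1)
    have hUm' : Measurable U := hUm.mono (innov_le hε _) le_rfl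
    have hVm' := measurable_past' hε s
    have e1 : ∀ ω, F.sup' hF (fun f => |G f (past ε t ω) - G f (pastStar ε ε' t m ω)|)
        = R (U ω) (ε' (t - m) ω) (past ε s ω) := fun ω => by
      have h1 : splice (m + 1) (past ε t ω) (past ε s ω) = past ε t ω := splice_past t (m + 1) ω
      rw [hRU]
      simp only [hR, ← update_splice, h1, pastStar]
    have hμ' : P.map (ε' (t - m)) = μ :=
      (hε.copy_ident _).map_eq.trans (hε.ident _ 0).map_eq
    have hind : IndepFun (fun ω => (U ω, past ε s ω)) (ε' (t - m)) P := by
      have h1 : Measurable fun z : ℤ → Fin d' → ℝ =>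
          ((splice (m + 1) (fun k : ℕ => z (t - k)) 0 : ℕ → Fin d' → ℝ),
            (fun k : ℕ => z (s - k))) := by
        refine Measurable.prodMk ((measurable_splice (m + 1)).comp
          (Measurable.prodMk ?_ measurable_const)) ?_ <;> fun_prop
      exact ((hε.copy_indep (t - m)).comp measurable_id h1).symm
    have h1 := integral_indep hind (hUm'.prodMk hVm') (hε.measurable_copy _) hRb'.1
      (C := (2 * M) ^ 2) fun ω ω' => by
        rw [abs_of_nonneg (sq_nonneg _)]
        exact hRM _ _ _
    have hdisj : Disjoint (Set.Ioc s t) (Set.Iic s) :=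
      Set.disjoint_left.2 fun a ha hb => absurd ha.1 (not_lt.2 hb)
    have h2 := integral_innov hε hdisj hUm measurable_past hRb2.1 (C := (2 * M) ^ 2) fun ω ω' =>
      abs_integral_le_of_abs_le fun e => by
        rw [abs_of_nonneg (sq_nonneg _)]
        exact hRM _ _ _
    simp only [e1]
    rw [h1, hμ', h2, map_past hε]
    simp only [hRU, hQ]
  rw [hrhs]
  have hL : BddMeas mΩ fun ω => (F.sup' hF fun f => |incr P ε (G f) t m ω|) ^ 2 :=
    (BddMeas.sup' hF fun f hf =>
      ((bddMeas_incr hε (hG f hf) (hGM f hf) t m).mono (innov_le hε _)).abs).pow_two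
  have hRR : BddMeas mΩ fun ω => ∫ y, ∫ e, R (past ε t ω) e y ^ 2 ∂μ ∂Q :=
    (BddMeas.integral_prod (h := fun x y => ∫ e, R x e y ^ 2 ∂μ) hRb2).comp (measurable_past' hε t)
  exact integral_mono hL.integrable hRR.integrable hpt

/-! ### Convergence of the approximations -/

lemma tendsto_integral_abs_sub_approx (hε : IsInnovation P ε ε') (hG : Measurable G)
    (hGM : ∀ x, |G x| ≤ M) (t : ℤ) :
    Filter.Tendsto (fun m => ∫ ω, |G (past ε t ω) - approx P ε G t m ω| ∂P)
      Filter.atTop (nhds 0) := by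
  let ℱ : Filtration ℕ mΩ :=
    { seq := fun m => innov ε (Set.Ioc (t - m) t)
      mono' := fun a b hab => innov_mono (Set.Ioc_subset_Ioc_left (by omega))
      le' := fun m => innov_le hε _ }
  have hW := bddMeas_past hε hG hGM t
  have hWm : Measurable[⨆ m, ℱ m] fun ω => G (past ε t ω) := by
    refine hG.comp ?_
    refine @measurable_pi_lambda _ _ _ (⨆ m, ℱ m) _ _ fun k => ?_
    have h1 : Measurable[ℱ (k + 1)] (ε (t - k)) := measurable_innov (by
      simp only [Set.mem_Ioc]
      push_cast
      omega)
    exact h1.mono (le_iSup ℱ (k + 1)) le_rfl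
  have hlim := hW.integrable.tendsto_eLpNorm_condExp (μ := P) (ℱ := ℱ) hWm.stronglyMeasurable
  have hae : ∀ m, approx P ε G t m =ᵐ[P] P[fun ω => G (past ε t ω) | ℱ m] := by
    intro m
    have ha := bddMeas_approx hε hG hGM t m
    have ha' := ha.mono (innov_le hε _)
    refine ae_eq_condExp_of_forall_setIntegral_eq (ℱ.le m) hW.integrable
      (fun s _ _ => ha'.integrable.integrableOn) (fun s hs _ => ?_)
      ha.1.stronglyMeasurable.aestronglyMeasurable
    have hψ : BddMeas (innov ε (Set.Ioi (t - m))) (s.indicator fun _ => (1 : ℝ)) := by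
      refine BddMeas.mono (innov_mono (Ioc_subset_Ioi_of_le le_rfl))
        ⟨measurable_const.indicator hs, 1, fun ω => ?_⟩
      by_cases h : ω ∈ s <;> simp [h]
    have h := integral_mul_approx hε hG hGM t m hψ
    have hs' : MeasurableSet s := innov_le hε _ s hs
    rw [← integral_indicator hs', ← integral_indicator hs']
    have e : ∀ φ : Ω → ℝ, (fun ω => s.indicator (fun _ => (1 : ℝ)) ω * φ ω) = s.indicator φ :=
      fun φ => by
        funext ω
        by_cases hω : ω ∈ s <;> simp [hω]
    rw [e, e] at h
    exact h
  have hreal := (ENNReal.tendsto_toReal ENNReal.zero_ne_top).comp hlim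
  simp only [ENNReal.toReal_zero] at hreal
  refine hreal.congr fun m => ?_
  have ha' := (bddMeas_approx hε hG hGM t m).mono (innov_le hε _)
  have h1 : eLpNorm (P[fun ω => G (past ε t ω) | ℱ m] - fun ω => G (past ε t ω)) 1 P
      = eLpNorm (fun ω => G (past ε t ω) - approx P ε G t m ω) 1 P := by
    rw [← eLpNorm_neg]
    refine eLpNorm_congr_ae ?_
    filter_upwards [hae m] with ω hω
    simp [hω]
  simp only [Function.comp]
  rw [h1, eLpNorm_one_eq_lintegral_enorm,
    ← integral_norm_eq_lintegral_enorm (hW.sub ha').1.aestronglyMeasurable]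
  simp only [Real.norm_eq_abs]

end

/-! ### The norm of a maximum -/

section

variable {Ω ι : Type*} {mΩ : MeasurableSpace Ω} {P : Measure Ω}
  {F : Finset ι} {hF : F.Nonempty}

/-- The norm `𝔼 max_{f ∈ F} |X_f|` of a random vector. -/
def maxNorm (P : Measure Ω) (F : Finset ι) (hF : F.Nonempty) (X : ι → Ω → ℝ) : ℝ :=
  ∫ ω, F.sup' hF (fun f => |X f ω|) ∂P

lemma maxNorm_congr {X Y : ι → Ω → ℝ} (h : ∀ f ∈ F, ∀ ω, X f ω = Y f ω) :
    maxNorm P F hF X = maxNorm P F hF Y := by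
  unfold maxNorm
  congr 1
  funext ω
  exact Finset.sup'_congr hF rfl fun f hf => by rw [h f hf ω]

variable [IsProbabilityMeasure P]

lemma maxNorm_add_le {X Y : ι → Ω → ℝ} (hX : ∀ f ∈ F, BddMeas mΩ (X f))
    (hY : ∀ f ∈ F, BddMeas mΩ (Y f)) :
    maxNorm P F hF (fun f ω => X f ω + Y f ω) ≤ maxNorm P F hF X + maxNorm P F hF Y := by
  have h1 := BddMeas.sup' hF fun f hf => (hX f hf).abs
  have h2 := BddMeas.sup' hF fun f hf => (hY f hf).abs
  have h3 := BddMeas.sup' hF fun f hf => ((hX f hf).add (hY f hf)).abs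
  unfold maxNorm
  rw [← integral_add h1.integrable h2.integrable]
  refine integral_mono h3.integrable (h1.add h2).integrable fun ω => ?_
  exact Finset.sup'_le hF _ fun f hf => (abs_add_le _ _).trans
    (add_le_add (Finset.le_sup' (fun f => |X f ω|) hf) (Finset.le_sup' (fun f => |Y f ω|) hf))

lemma maxNorm_sum_le {κ : Type*} {s : Finset κ} {X : κ → ι → Ω → ℝ}
    (hX : ∀ k ∈ s, ∀ f ∈ F, BddMeas mΩ (X k f)) :
    maxNorm P F hF (fun f ω => ∑ k ∈ s, X k f ω) ≤ ∑ k ∈ s, maxNorm P F hF (X k) := by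
  classical
  induction s using Finset.induction_on with
  | empty => simp [maxNorm]
  | insert a s ha ih =>
    have h1 := hX a (Finset.mem_insert_self a s)
    have h2 : ∀ k ∈ s, ∀ f ∈ F, BddMeas mΩ (X k f) := fun k hk => hX k (Finset.mem_insert_of_mem hk)
    simp only [Finset.sum_insert ha]
    exact (maxNorm_add_le h1 fun f hf => BddMeas.sum fun k hk => h2 k hk f hf).trans
      (add_le_add le_rfl (ih h2))

lemma maxNorm_le_sum {X : ι → Ω → ℝ} (hX : ∀ f ∈ F, BddMeas mΩ (X f)) :
    maxNorm P F hF X ≤ ∑ f ∈ F, ∫ ω, |X f ω| ∂P := by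
  rw [← integral_finsetSum _ fun f hf => (hX f hf).abs.integrable]
  refine integral_mono (BddMeas.sup' hF fun f hf => (hX f hf).abs).integrable
    (BddMeas.sum fun f hf => (hX f hf).abs).integrable fun ω => ?_
  exact Finset.sup'_le hF _ fun f hf =>
    Finset.single_le_sum (f := fun f => |X f ω|) (fun _ _ => abs_nonneg _) hf

/-- Minkowski's inequality for the norm of `ℓ²(L²)`. -/
lemma sum_integral_sum_sq_le {β κ : Type*} {t : Finset β} {s : Finset κ} {Z : β → κ → Ω → ℝ}
    (hZ : ∀ b ∈ t, ∀ k ∈ s, BddMeas mΩ (Z b k)) {A : κ → ℝ} (hA : ∀ k ∈ s, 0 ≤ A k)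
    (h : ∀ k ∈ s, ∑ b ∈ t, ∫ ω, Z b k ω ^ 2 ∂P ≤ A k ^ 2) :
    ∑ b ∈ t, ∫ ω, (∑ k ∈ s, Z b k ω) ^ 2 ∂P ≤ (∑ k ∈ s, A k) ^ 2 := by
  -- Cauchy–Schwarz with the weights `A k + δ`, where `δ > 0` avoids division by zero
  have key : ∀ δ : ℝ, 0 < δ → ∑ b ∈ t, ∫ ω, (∑ k ∈ s, Z b k ω) ^ 2 ∂P ≤
      (∑ k ∈ s, (A k + δ)) ^ 2 := by
    intro δ hδ
    have ha : ∀ k ∈ s, 0 < A k + δ := fun k hk => add_pos_of_nonneg_of_pos (hA k hk) hδ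
    have hs0 : 0 ≤ ∑ k ∈ s, (A k + δ) := Finset.sum_nonneg fun k hk => (ha k hk).le
    calc ∑ b ∈ t, ∫ ω, (∑ k ∈ s, Z b k ω) ^ 2 ∂P
        ≤ ∑ b ∈ t, ∫ ω, (∑ k ∈ s, (A k + δ)) * ∑ k ∈ s, (A k + δ)⁻¹ * Z b k ω ^ 2 ∂P := by
          refine Finset.sum_le_sum fun b hb => integral_mono
            (BddMeas.sum fun k hk => hZ b hb k hk).pow_two.integrable
            ((BddMeas.sum fun k hk => (hZ b hb k hk).pow_two.const_mul _).const_mul _).integrable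
            fun ω => ?_
          refine Finset.sum_sq_le_sum_mul_sum_of_sq_le_mul s (fun k hk => (ha k hk).le)
            (fun k hk => mul_nonneg (inv_pos.2 (ha k hk)).le (sq_nonneg _)) fun k hk => ?_
          rw [← mul_assoc, mul_inv_cancel₀ (ha k hk).ne', one_mul]
      _ = (∑ k ∈ s, (A k + δ)) * ∑ k ∈ s, (A k + δ)⁻¹ * ∑ b ∈ t, ∫ ω, Z b k ω ^ 2 ∂P := by
          simp only [integral_const_mul, ← Finset.mul_sum]
          congr 1
          simp only [Finset.mul_sum]
          rw [Finset.sum_comm]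
          refine Finset.sum_congr rfl fun b hb => ?_
          rw [integral_finsetSum _ fun k hk => ((hZ b hb k hk).pow_two.const_mul _).integrable]
          simp only [integral_const_mul]
      _ ≤ (∑ k ∈ s, (A k + δ)) * ∑ k ∈ s, (A k + δ) := by
          refine mul_le_mul_of_nonneg_left (Finset.sum_le_sum fun k hk => ?_) hs0
          rw [inv_mul_le_iff₀ (ha k hk), ← sq]
          exact (h k hk).trans (pow_le_pow_left₀ (hA k hk) (by linarith) 2)
      _ = _ := (sq _).symm
  refine (Real.sqrt_le_left (Finset.sum_nonneg hA)).1 ?_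
  refine le_of_forall_pos_le_add fun δ hδ => ?_
  have hδ' : 0 < δ / (s.card + 1) := by positivity
  have h1 := Real.sqrt_le_sqrt (key _ hδ')
  rw [Real.sqrt_sq (Finset.sum_nonneg fun k hk => add_nonneg (hA k hk) hδ'.le)] at h1
  refine h1.trans ?_
  rw [Finset.sum_add_distrib, Finset.sum_const, nsmul_eq_mul]
  have : (s.card : ℝ) * (δ / (s.card + 1)) ≤ δ := by
    rw [mul_div_assoc', div_le_iff₀ (by positivity)]
    nlinarith
  linarith

end

section

variable {Ω ι : Type*} {mΩ : MeasurableSpace Ω} {P : Measure Ω} {d' : ℕ}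
  {ε ε' : ℤ → Ω → Fin d' → ℝ} {M : ℝ}

/-! ### The tail of the approximation -/

lemma approx_sub_approx (G : (ℕ → Fin d' → ℝ) → ℝ) (t : ℤ) {p q : ℕ} (hpq : p ≤ q) (ω : Ω) :
    approx P ε G t q ω - approx P ε G t p ω = ∑ m ∈ Finset.Ico p q, incr P ε G t m ω :=
  (Finset.sum_Ico_sub (fun m => approx P ε G t m ω) hpq).symm

variable [IsProbabilityMeasure P]

/-- In reversed time the increments at a fixed depth `m` form a martingale difference sequence. -/
lemma maxNorm_sum_incr_le {F : Finset ι} (hF : F.Nonempty) (hε : IsInnovation P ε ε')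
    {G : ℤ → ι → (ℕ → Fin d' → ℝ) → ℝ} (hG : ∀ t, ∀ f ∈ F, Measurable (G t f))
    (hGM : ∀ t, ∀ f ∈ F, ∀ x, |G t f x| ≤ M) (n m : ℕ) {v : ℝ} (hv0 : 0 ≤ v)
    (hv : ∑ i ∈ Finset.range n, ∫ ω, (F.sup' hF fun f =>
      |incr P ε (G (i + 1) f) (i + 1) m ω|) ^ 2 ∂P ≤ v ^ 2) :
    maxNorm P F hF (fun f ω => ∑ i ∈ Finset.range n, incr P ε (G (i + 1) f) (i + 1) m ω) ≤
      5 * Real.sqrt (Real.log (2 * F.card)) * v := by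
  have hrefl : ∀ φ : ℤ → ℝ, ∑ b ∈ Finset.range n, φ (n - b)
      = ∑ i ∈ Finset.range n, φ (i + 1) := fun φ => by
    rw [← Finset.sum_range_reflect]
    refine Finset.sum_congr rfl fun i hi => ?_
    have := Finset.mem_range.1 hi
    congr 1
    omega
  have h := integral_sup_abs_sum_le_of_martingaleDifference (P := P) hF
    (𝒢 := fun b : ℕ => innov ε (Set.Ioi ((n : ℤ) - b - m))) (fun b => innov_le hε _)
    (fun a b hab => innov_mono (Set.Ioi_subset_Ioi (by omega)))
    (Y := fun b f => incr P ε (G (n - b) f) (n - b) m)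
    (fun b f hf => (bddMeas_incr hε (hG _ f hf) (hGM _ f hf) _ m).mono
      (innov_mono (Ioc_subset_Ioi_of_le (by push_cast; omega))))
    (fun b f hf ψ hψ => integral_mul_incr hε (hG _ f hf) (hGM _ f hf) _ m hψ) n hv0
    ((hrefl fun t => ∫ ω, (F.sup' hF fun f => |incr P ε (G t f) t m ω|) ^ 2 ∂P).trans_le hv)
  refine le_trans (le_of_eq (maxNorm_congr fun f _ ω => ?_)) h
  exact (hrefl fun t => incr P ε (G t f) t m ω).symm

/-- The error of the approximation by functions of `q` innovations. -/
lemma maxNorm_sum_sub_approx_le {F : Finset ι} (hF : F.Nonempty) (hε : IsInnovation P ε ε')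
    {G : ℤ → ι → (ℕ → Fin d' → ℝ) → ℝ} (hG : ∀ t, ∀ f ∈ F, Measurable (G t f))
    (hGM : ∀ t, ∀ f ∈ F, ∀ x, |G t f x| ≤ M) (n q : ℕ) {v : ℕ → ℝ} (hv0 : ∀ m, 0 ≤ v m)
    (hv : ∀ m, q ≤ m → ∑ i ∈ Finset.range n, ∫ ω, (F.sup' hF fun f =>
      |incr P ε (G (i + 1) f) (i + 1) m ω|) ^ 2 ∂P ≤ v m ^ 2)
    {T : ℝ} (hT : ∀ N, ∑ m ∈ Finset.Ico q N, v m ≤ T) :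
    maxNorm P F hF (fun f ω => ∑ i ∈ Finset.range n,
      (G (i + 1) f (past ε (i + 1) ω) - approx P ε (G (i + 1) f) (i + 1) q ω)) ≤
      5 * Real.sqrt (Real.log (2 * F.card)) * T := by
  set r : ℕ → ℝ := fun N => ∑ f ∈ F, ∑ i ∈ Finset.range n,
    ∫ ω, |G (i + 1) f (past ε (i + 1) ω) - approx P ε (G (i + 1) f) (i + 1) N ω| ∂P with hr
  have hrlim : Filter.Tendsto (fun N => r N + 5 * Real.sqrt (Real.log (2 * F.card)) * T)
      Filter.atTop (nhds (5 * Real.sqrt (Real.log (2 * F.card)) * T)) := by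
    have h0 : Filter.Tendsto r Filter.atTop (nhds 0) := by
      have := tendsto_finsetSum F fun f hf => tendsto_finsetSum (Finset.range n) fun i _ =>
        tendsto_integral_abs_sub_approx hε (hG (i + 1) f hf) (hGM (i + 1) f hf) (i + 1)
      simpa using this
    simpa using h0.add_const (5 * Real.sqrt (Real.log (2 * F.card)) * T)
  refine ge_of_tendsto hrlim ?_
  filter_upwards [Filter.eventually_ge_atTop q] with N hN
  have ha : ∀ m (i : ℕ), ∀ f ∈ F, BddMeas mΩ (approx P ε (G (i + 1) f) (i + 1) m) :=
    fun m i f hf => (bddMeas_approx hε (hG _ f hf) (hGM _ f hf) _ m).mono (innov_le hε _)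
  have hW : ∀ i : ℕ, ∀ f ∈ F, BddMeas mΩ fun ω => G (i + 1) f (past ε (i + 1) ω) :=
    fun i f hf => bddMeas_past hε (hG _ f hf) (hGM _ f hf) _
  have hi : ∀ m (i : ℕ), ∀ f ∈ F, BddMeas mΩ (incr P ε (G (i + 1) f) (i + 1) m) :=
    fun m i f hf => (bddMeas_incr hε (hG _ f hf) (hGM _ f hf) _ m).mono (innov_le hε _)
  have hsplit : maxNorm P F hF (fun f ω => ∑ i ∈ Finset.range n,
      (G (i + 1) f (past ε (i + 1) ω) - approx P ε (G (i + 1) f) (i + 1) q ω)) =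
      maxNorm P F hF (fun f ω => (∑ i ∈ Finset.range n,
        (G (i + 1) f (past ε (i + 1) ω) - approx P ε (G (i + 1) f) (i + 1) N ω)) +
        ∑ m ∈ Finset.Ico q N, ∑ i ∈ Finset.range n, incr P ε (G (i + 1) f) (i + 1) m ω) := by
    refine maxNorm_congr fun f _ ω => ?_
    rw [Finset.sum_comm, ← Finset.sum_add_distrib]
    refine Finset.sum_congr rfl fun i _ => ?_
    rw [← approx_sub_approx _ _ hN]
    ring
  rw [hsplit]
  refine (maxNorm_add_le (fun f hf => BddMeas.sum fun i _ => (hW i f hf).sub (ha N i f hf))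
    fun f hf => BddMeas.sum fun m _ => BddMeas.sum fun i _ => hi m i f hf).trans ?_
  refine add_le_add ?_ ?_
  · refine (maxNorm_le_sum fun f hf => BddMeas.sum fun i _ =>
      (hW i f hf).sub (ha N i f hf)).trans (Finset.sum_le_sum fun f hf => ?_)
    rw [← integral_finsetSum _ fun i _ => ((hW i f hf).sub (ha N i f hf)).abs.integrable]
    exact integral_mono (BddMeas.sum fun i _ => (hW i f hf).sub (ha N i f hf)).abs.integrable
      (BddMeas.sum fun i _ => ((hW i f hf).sub (ha N i f hf)).abs).integrable
      fun ω => Finset.abs_sum_le_sum_abs _ _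
  · refine (maxNorm_sum_le fun m _ f hf => BddMeas.sum fun i _ => hi m i f hf).trans ?_
    refine (Finset.sum_le_sum fun m hm => maxNorm_sum_incr_le hF hε hG hGM n m (hv0 m)
      (hv m (Finset.mem_Ico.1 hm).1)).trans ?_
    rw [← Finset.mul_sum]
    exact mul_le_mul_of_nonneg_left (hT N) (by positivity)

/-! ### Blocks -/

lemma integral_sum_incr_sq (hε : IsInnovation P ε ε') {G : ℤ → (ℕ → Fin d' → ℝ) → ℝ}
    (hG : ∀ t, Measurable (G t)) (hGM : ∀ t x, |G t x| ≤ M) (m : ℕ) (s : Finset ℕ) :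
    ∫ ω, (∑ i ∈ s, incr P ε (G (i + 1)) (i + 1) m ω) ^ 2 ∂P =
      ∑ i ∈ s, ∫ ω, incr P ε (G (i + 1)) (i + 1) m ω ^ 2 ∂P := by
  have h0 : ∀ i : ℕ, BddMeas (innov ε (Set.Ioc ((i : ℤ) + 1 - m - 1) (i + 1)))
      (incr P ε (G (i + 1)) (i + 1) m) := fun i => bddMeas_incr hε (hG _) (hGM _) _ m
  have hi : ∀ i : ℕ, BddMeas mΩ (incr P ε (G (i + 1)) (i + 1) m) :=
    fun i => (h0 i).mono (innov_le hε _)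
  have horth : ∀ i j : ℕ, i < j → ∫ ω, incr P ε (G (j + 1)) (j + 1) m ω *
      incr P ε (G (i + 1)) (i + 1) m ω ∂P = 0 := fun i j hij =>
    integral_mul_incr hε (hG _) (hGM _) _ m
      ((h0 j).mono (innov_mono (Ioc_subset_Ioi_of_le (by omega))))
  have e : ∀ ω, (∑ i ∈ s, incr P ε (G (i + 1)) (i + 1) m ω) ^ 2 =
      ∑ i ∈ s, ∑ j ∈ s, incr P ε (G (i + 1)) (i + 1) m ω * incr P ε (G (j + 1)) (j + 1) m ω :=
    fun ω => by rw [sq, Finset.sum_mul_sum]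
  simp only [e]
  rw [integral_finsetSum _ fun i _ => (BddMeas.sum fun j _ => (hi i).mul (hi j)).integrable]
  refine Finset.sum_congr rfl fun i his => ?_
  rw [integral_finsetSum _ fun j _ => ((hi i).mul (hi j)).integrable,
    Finset.sum_eq_single i ?_ fun h => absurd his h]
  · simp only [sq]
  · intro j _ hji
    rcases lt_or_gt_of_ne hji with h | h
    · exact horth j i h
    · simpa only [mul_comm] using horth i j h

/-- The indices `i < n` in the block number `b` of length `q`. -/
def block (n q b : ℕ) : Finset ℕ := (Finset.range n).filter fun i => i / q = b

lemma card_block_le (n : ℕ) {q : ℕ} (hq : 0 < q) (b : ℕ) : (block n q b).card ≤ q := by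
  have h : block n q b ⊆ Finset.Ico (b * q) (b * q + q) := by
    intro i hi
    have h1 := (Finset.mem_filter.1 hi).2
    rw [Finset.mem_Ico]
    have h2 := Nat.div_add_mod i q
    have h3 := Nat.mod_lt i hq
    rw [h1, mul_comm] at h2
    constructor <;> omega
  simpa using Finset.card_le_card h

/-- The blocks with numbers `r, r + 2, r + 4, …` together select the indices `i` for which `i / q` is
one of these numbers; `n` blocks suffice, since `i / q < n`. -/
lemma sum_block (n q r : ℕ) (x : ℕ → ℝ) : ∑ c ∈ Finset.range n, ∑ i ∈ block n q (2 * c + r), x i =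
    ∑ i ∈ Finset.range n, if r ≤ i / q ∧ (i / q - r) % 2 = 0 then x i else 0 := by
  simp only [block, Finset.sum_filter]
  rw [Finset.sum_comm]
  refine Finset.sum_congr rfl fun i hi => ?_
  have hi' := Finset.mem_range.1 hi
  have hle := Nat.div_le_self i q
  split_ifs with h
  · rw [Finset.sum_eq_single ((i / q - r) / 2)]
    · rw [if_pos (by omega)]
    · intro c _ hc
      rw [if_neg (by omega)]
    · intro hc
      rw [Finset.mem_range] at hc
      omega
  · refine Finset.sum_eq_zero fun c _ => ?_
    rw [if_neg (by omega)]

/-- The blocks of the same parity are independent if a block of length `q` is combined from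
functions of at most `q` innovations. -/
lemma maxNorm_sum_blocks_le {F : Finset ι} (hF : F.Nonempty) (hε : IsInnovation P ε ε')
    {G : ℤ → ι → (ℕ → Fin d' → ℝ) → ℝ} (hG : ∀ t, ∀ f ∈ F, Measurable (G t f))
    (hGM : ∀ t, ∀ f ∈ F, ∀ x, |G t f x| ≤ M) (hM : 0 ≤ M) (n r : ℕ) {p q : ℕ} (hpq : p < q)
    {A : ℕ → ℝ} (hA0 : ∀ m, 0 ≤ A m)
    (hA : ∀ m, ∀ f ∈ F, ∑ i ∈ Finset.range n,
      ∫ ω, incr P ε (G (i + 1) f) (i + 1) m ω ^ 2 ∂P ≤ A m ^ 2) :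
    maxNorm P F hF (fun f ω => ∑ c ∈ Finset.range n, ∑ i ∈ block n q (2 * c + r),
      (approx P ε (G (i + 1) f) (i + 1) q ω - approx P ε (G (i + 1) f) (i + 1) p ω)) ≤
      2 * Real.sqrt (Real.log (2 * F.card)) * ∑ m ∈ Finset.Ico p q, A m +
        2 * q * M * Real.log (2 * F.card) := by
  have hq0 : 0 < q := by omega
  have hU : ∀ (i : ℕ), ∀ f ∈ F, BddMeas (innov ε (Set.Ioc ((i : ℤ) + 1 - q) (i + 1)))
      fun ω => approx P ε (G (i + 1) f) (i + 1) q ω - approx P ε (G (i + 1) f) (i + 1) p ω :=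
    fun i f hf => (bddMeas_approx hε (hG _ f hf) (hGM _ f hf) _ q).sub
      ((bddMeas_approx hε (hG _ f hf) (hGM _ f hf) _ p).mono
        (innov_mono (Set.Ioc_subset_Ioc_left (by omega))))
  have ha : ∀ m (i : ℕ), ∀ f ∈ F, BddMeas mΩ (approx P ε (G (i + 1) f) (i + 1) m) :=
    fun m i f hf => (bddMeas_approx hε (hG _ f hf) (hGM _ f hf) _ m).mono (innov_le hε _)
  have hmem : ∀ {i b : ℕ}, i ∈ block n q b →
      (b : ℤ) * q ≤ i ∧ (i : ℤ) + 1 ≤ ((b : ℤ) + 1) * q := by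
    intro i b hi
    have h1 := (Finset.mem_filter.1 hi).2
    have h2 := Nat.div_add_mod i q
    have h3 := Nat.mod_lt i hq0
    rw [h1, mul_comm] at h2
    have h4 : (b : ℤ) * q + (i % q : ℕ) = i := by exact_mod_cast h2
    constructor
    · omega
    · rw [add_mul]
      omega
  refine integral_sup_abs_sum_le_of_indep hF
    (𝒢 := fun c : ℕ => innov ε (Set.Iic ((2 * (c : ℤ) + r - 1) * q))) (fun _ => innov_le hε _)
    (fun a b hab => innov_mono (Set.Iic_subset_Iic.2 ?_)) (C := 2 * q * M)
    (T := fun c f ω => ∑ i ∈ block n q (2 * c + r),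
      (approx P ε (G (i + 1) f) (i + 1) q ω - approx P ε (G (i + 1) f) (i + 1) p ω))
    (fun c f hf => BddMeas.sum fun i hi => (hU i f hf).mono (innov_mono ?_))
    (by positivity) (fun c f hf ω => ?_) (fun c f hf => ?_) (fun c f hf => ?_) n
    (Finset.sum_nonneg fun m _ => hA0 m) (fun f hf => ?_)
  · have : (a : ℤ) ≤ b := by exact_mod_cast hab
    exact mul_le_mul_of_nonneg_right (by omega) (by positivity)
  · intro k hk
    have := (hmem hi).2
    push_cast at this ⊢
    exact hk.2.trans (this.trans (le_of_eq (by ring)))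
  · refine (Finset.abs_sum_le_sum_abs _ _).trans ?_
    refine (Finset.sum_le_card_nsmul _ _ (2 * M) fun i _ => ?_).trans ?_
    · have h1 := abs_le.1 (abs_approx_le hε (hGM (i + 1) f hf) (i + 1) q ω)
      have h2 := abs_le.1 (abs_approx_le hε (hGM (i + 1) f hf) (i + 1) p ω)
      exact abs_le.2 ⟨by linarith, by linarith⟩
    · rw [nsmul_eq_mul]
      have : ((block n q (2 * c + r)).card : ℝ) ≤ q := by exact_mod_cast card_block_le n hq0 _
      calc _ ≤ (q : ℝ) * (2 * M) := mul_le_mul_of_nonneg_right this (by positivity)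
        _ = _ := by ring
  · rw [integral_finsetSum _ fun i _ => ((ha q i f hf).sub (ha p i f hf)).integrable]
    refine Finset.sum_eq_zero fun i _ => ?_
    rw [integral_sub (ha q i f hf).integrable (ha p i f hf).integrable,
      integral_approx hε (hG _ f hf) (hGM _ f hf), integral_approx hε (hG _ f hf) (hGM _ f hf),
      sub_self]
  · have hdisj : Disjoint (Set.Iic ((2 * (c : ℤ) + r - 1) * q))
        (Set.Ioi ((2 * (c : ℤ) + r - 1) * q)) :=
      Set.disjoint_left.2 fun a ha hb => absurd (Set.mem_Ioi.1 hb) (not_lt.2 ha)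
    refine indep_of_indep_of_le_right (indep_innov hε hdisj) (Measurable.comap_le ?_)
    refine (BddMeas.sum fun i hi => (hU i f hf).mono (innov_mono (Ioc_subset_Ioi_of_le ?_))).1
    have := (hmem hi).1
    push_cast at this
    have e : (2 * (c : ℤ) + r - 1) * q = (2 * c + r) * q - q := by ring
    rw [e]
    omega
  · simp only [approx_sub_approx _ _ hpq.le]
    have e : ∀ c ω, ∑ i ∈ block n q (2 * c + r), ∑ m ∈ Finset.Ico p q,
        incr P ε (G (i + 1) f) (i + 1) m ω = ∑ m ∈ Finset.Ico p q, ∑ i ∈ block n q (2 * c + r),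
        incr P ε (G (i + 1) f) (i + 1) m ω := fun c ω => Finset.sum_comm
    simp only [e]
    refine sum_integral_sum_sq_le (fun c _ m _ => BddMeas.sum fun i _ =>
      (bddMeas_incr hε (hG _ f hf) (hGM _ f hf) _ m).mono (innov_le hε _)) (fun m _ => hA0 m)
      fun m _ => ?_
    simp only [integral_sum_incr_sq hε (G := fun t => G t f) (fun t => hG t f hf)
      (fun t => hGM t f hf)]
    rw [sum_block]
    refine le_trans (Finset.sum_le_sum fun i _ => ?_) (hA m f hf)
    split_ifs
    · exact le_rfl
    · exact integral_nonneg fun ω => sq_nonneg _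

/-- The layer between the depths `p` and `q`, as the sum of its even and its odd blocks. -/
lemma maxNorm_sum_layer_le {F : Finset ι} (hF : F.Nonempty) (hε : IsInnovation P ε ε')
    {G : ℤ → ι → (ℕ → Fin d' → ℝ) → ℝ} (hG : ∀ t, ∀ f ∈ F, Measurable (G t f))
    (hGM : ∀ t, ∀ f ∈ F, ∀ x, |G t f x| ≤ M) (hM : 0 ≤ M) (n : ℕ) {p q : ℕ} (hpq : p < q)
    {A : ℕ → ℝ} (hA0 : ∀ m, 0 ≤ A m)
    (hA : ∀ m, ∀ f ∈ F, ∑ i ∈ Finset.range n,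
      ∫ ω, incr P ε (G (i + 1) f) (i + 1) m ω ^ 2 ∂P ≤ A m ^ 2) :
    maxNorm P F hF (fun f ω => ∑ i ∈ Finset.range n,
      (approx P ε (G (i + 1) f) (i + 1) q ω - approx P ε (G (i + 1) f) (i + 1) p ω)) ≤
      4 * Real.sqrt (Real.log (2 * F.card)) * ∑ m ∈ Finset.Ico p q, A m +
        4 * q * M * Real.log (2 * F.card) := by
  have ha : ∀ m (i : ℕ), ∀ f ∈ F, BddMeas mΩ (approx P ε (G (i + 1) f) (i + 1) m) :=
    fun m i f hf => (bddMeas_approx hε (hG _ f hf) (hGM _ f hf) _ m).mono (innov_le hε _)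
  have hT : ∀ r : ℕ, ∀ f ∈ F, BddMeas mΩ fun ω => ∑ c ∈ Finset.range n,
      ∑ i ∈ block n q (2 * c + r),
      (approx P ε (G (i + 1) f) (i + 1) q ω - approx P ε (G (i + 1) f) (i + 1) p ω) :=
    fun r f hf => BddMeas.sum fun c _ => BddMeas.sum fun i _ => (ha q i f hf).sub (ha p i f hf)
  have hsplit : maxNorm P F hF (fun f ω => ∑ i ∈ Finset.range n,
      (approx P ε (G (i + 1) f) (i + 1) q ω - approx P ε (G (i + 1) f) (i + 1) p ω)) =
      maxNorm P F hF (fun f ω =>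
        (∑ c ∈ Finset.range n, ∑ i ∈ block n q (2 * c + 0),
          (approx P ε (G (i + 1) f) (i + 1) q ω - approx P ε (G (i + 1) f) (i + 1) p ω)) +
        ∑ c ∈ Finset.range n, ∑ i ∈ block n q (2 * c + 1),
          (approx P ε (G (i + 1) f) (i + 1) q ω - approx P ε (G (i + 1) f) (i + 1) p ω)) := by
    refine maxNorm_congr fun f _ ω => ?_
    rw [sum_block, sum_block, ← Finset.sum_add_distrib]
    refine Finset.sum_congr rfl fun i _ => ?_
    generalize i / q = k
    by_cases h : k % 2 = 0
    · rw [if_pos (by omega), if_neg (by omega), add_zero]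
    · rw [if_neg (by omega), if_pos (by omega), zero_add]
  rw [hsplit]
  refine (maxNorm_add_le (hT 0) (hT 1)).trans ?_
  have h0 := maxNorm_sum_blocks_le hF hε hG hGM hM n 0 hpq hA0 hA
  have h1 := maxNorm_sum_blocks_le hF hε hG hGM hM n 1 hpq hA0 hA
  linarith

/-- Summation over the layers `q/2 → q`, `q/4 → q/2`, …: the terms that are linear in the length of
the blocks form a geometric series. -/
lemma maxNorm_sum_approx_le {F : Finset ι} (hF : F.Nonempty) (hε : IsInnovation P ε ε')
    {G : ℤ → ι → (ℕ → Fin d' → ℝ) → ℝ} (hG : ∀ t, ∀ f ∈ F, Measurable (G t f))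
    (hGM : ∀ t, ∀ f ∈ F, ∀ x, |G t f x| ≤ M) (hM : 0 ≤ M) (n : ℕ)
    {A : ℕ → ℝ} (hA0 : ∀ m, 0 ≤ A m)
    (hA : ∀ m, ∀ f ∈ F, ∑ i ∈ Finset.range n,
      ∫ ω, incr P ε (G (i + 1) f) (i + 1) m ω ^ 2 ∂P ≤ A m ^ 2) (q : ℕ) :
    maxNorm P F hF (fun f ω => ∑ i ∈ Finset.range n,
      (approx P ε (G (i + 1) f) (i + 1) q ω - approx P ε (G (i + 1) f) (i + 1) 0 ω)) ≤
      4 * Real.sqrt (Real.log (2 * F.card)) * ∑ m ∈ Finset.range q, A m +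
        8 * q * M * Real.log (2 * F.card) := by
  induction q using Nat.strong_induction_on with
  | _ q ih =>
    rcases Nat.eq_zero_or_pos q with rfl | hq
    · simp [maxNorm]
    have hp : q / 2 < q := Nat.div_lt_self hq one_lt_two
    have ha : ∀ m (i : ℕ), ∀ f ∈ F, BddMeas mΩ (approx P ε (G (i + 1) f) (i + 1) m) :=
      fun m i f hf => (bddMeas_approx hε (hG _ f hf) (hGM _ f hf) _ m).mono (innov_le hε _)
    have hD : ∀ m m' : ℕ, ∀ f ∈ F, BddMeas mΩ fun ω => ∑ i ∈ Finset.range n,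
        (approx P ε (G (i + 1) f) (i + 1) m ω - approx P ε (G (i + 1) f) (i + 1) m' ω) :=
      fun m m' f hf => BddMeas.sum fun i _ => (ha m i f hf).sub (ha m' i f hf)
    have hsplit : maxNorm P F hF (fun f ω => ∑ i ∈ Finset.range n,
        (approx P ε (G (i + 1) f) (i + 1) q ω - approx P ε (G (i + 1) f) (i + 1) 0 ω)) =
        maxNorm P F hF (fun f ω => (∑ i ∈ Finset.range n,
        (approx P ε (G (i + 1) f) (i + 1) q ω - approx P ε (G (i + 1) f) (i + 1) (q / 2) ω)) +
          ∑ i ∈ Finset.range n, (approx P ε (G (i + 1) f) (i + 1) (q / 2) ω -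
            approx P ε (G (i + 1) f) (i + 1) 0 ω)) := by
      refine maxNorm_congr fun f _ ω => ?_
      rw [← Finset.sum_add_distrib]
      exact Finset.sum_congr rfl fun i _ => by ring
    rw [hsplit]
    refine (maxNorm_add_le (hD q (q / 2)) (hD (q / 2) 0)).trans ?_
    have h1 := maxNorm_sum_layer_le hF hε hG hGM hM n hp hA0 hA
    have h2 := ih (q / 2) hp
    have h3 : ∑ m ∈ Finset.range q, A m
        = ∑ m ∈ Finset.range (q / 2), A m + ∑ m ∈ Finset.Ico (q / 2) q, A m :=
      (Finset.sum_range_add_sum_Ico _ hp.le).symm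
    have hL0 : 0 ≤ Real.log (2 * F.card) := Real.log_nonneg (by
      have : (1 : ℝ) ≤ F.card := by exact_mod_cast hF.card_pos
      linarith)
    have h4 : ((q / 2 : ℕ) : ℝ) ≤ q / 2 := Nat.cast_div_le
    have h5 : 8 * ((q / 2 : ℕ) : ℝ) * M * Real.log (2 * F.card)
        ≤ 8 * ((q : ℝ) / 2) * M * Real.log (2 * F.card) := by gcongr
    rw [h3, mul_add]
    linarith

/-- The maximal inequality for bounded functions of the past, in terms of the second moments of the
increments. -/
theorem maxNorm_sum_sub_integral_le {F : Finset ι} (hF : F.Nonempty) (hε : IsInnovation P ε ε')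
    {G : ℤ → ι → (ℕ → Fin d' → ℝ) → ℝ} (hG : ∀ t, ∀ f ∈ F, Measurable (G t f))
    (hGM : ∀ t, ∀ f ∈ F, ∀ x, |G t f x| ≤ M) (hM : 0 ≤ M) (n q : ℕ)
    {A : ℕ → ℝ} (hA0 : ∀ m, 0 ≤ A m)
    (hA : ∀ m, ∀ f ∈ F, ∑ i ∈ Finset.range n,
      ∫ ω, incr P ε (G (i + 1) f) (i + 1) m ω ^ 2 ∂P ≤ A m ^ 2)
    {v : ℕ → ℝ} (hv0 : ∀ m, 0 ≤ v m)
    (hv : ∀ m, q ≤ m → ∑ i ∈ Finset.range n, ∫ ω, (F.sup' hF fun f =>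
      |incr P ε (G (i + 1) f) (i + 1) m ω|) ^ 2 ∂P ≤ v m ^ 2)
    {T : ℝ} (hT : ∀ N, ∑ m ∈ Finset.Ico q N, v m ≤ T) :
    maxNorm P F hF (fun f ω => ∑ i ∈ Finset.range n,
      (G (i + 1) f (past ε (i + 1) ω) - ∫ ω', G (i + 1) f (past ε (i + 1) ω') ∂P)) ≤
      4 * Real.sqrt (Real.log (2 * F.card)) * ∑ m ∈ Finset.range q, A m +
        5 * Real.sqrt (Real.log (2 * F.card)) * T + 8 * q * M * Real.log (2 * F.card) := by
  have ha : ∀ m (i : ℕ), ∀ f ∈ F, BddMeas mΩ (approx P ε (G (i + 1) f) (i + 1) m) :=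
    fun m i f hf => (bddMeas_approx hε (hG _ f hf) (hGM _ f hf) _ m).mono (innov_le hε _)
  have hW : ∀ i : ℕ, ∀ f ∈ F, BddMeas mΩ fun ω => G (i + 1) f (past ε (i + 1) ω) :=
    fun i f hf => bddMeas_past hε (hG _ f hf) (hGM _ f hf) _
  have hsplit : maxNorm P F hF (fun f ω => ∑ i ∈ Finset.range n,
      (G (i + 1) f (past ε (i + 1) ω) - ∫ ω', G (i + 1) f (past ε (i + 1) ω') ∂P)) =
      maxNorm P F hF (fun f ω => (∑ i ∈ Finset.range n,
        (G (i + 1) f (past ε (i + 1) ω) - approx P ε (G (i + 1) f) (i + 1) q ω)) +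
        ∑ i ∈ Finset.range n,
      (approx P ε (G (i + 1) f) (i + 1) q ω - approx P ε (G (i + 1) f) (i + 1) 0 ω)) := by
    refine maxNorm_congr fun f hf ω => ?_
    rw [← Finset.sum_add_distrib]
    refine Finset.sum_congr rfl fun i _ => ?_
    rw [approx_zero hε (hG _ f hf)]
    ring
  rw [hsplit]
  refine (maxNorm_add_le (fun f hf => BddMeas.sum fun i _ => (hW i f hf).sub (ha q i f hf))
    fun f hf => BddMeas.sum fun i _ => (ha q i f hf).sub (ha 0 i f hf)).trans ?_
  have h1 := maxNorm_sum_sub_approx_le hF hε hG hGM n q hv0 hv hT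
  have h2 := maxNorm_sum_approx_le hF hε hG hGM hM n hA0 hA q
  linarith

end

/-! ### Truncation of the functionals -/

/-- The truncation of `x` to the interval `[-M, M]`. -/
def clip (M x : ℝ) : ℝ := max (-M) (min x M)

lemma measurable_clip (M : ℝ) : Measurable (clip M) :=
  measurable_const.max (measurable_id.min measurable_const)

lemma abs_clip_le {M : ℝ} (hM : 0 ≤ M) (x : ℝ) : |clip M x| ≤ M :=
  abs_le.2 ⟨le_max_left _ _, max_le (by linarith) (min_le_right _ _)⟩

lemma clip_of_abs_le {M x : ℝ} (h : |x| ≤ M) : clip M x = x := by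
  rw [clip, min_eq_left (abs_le.1 h).2, max_eq_right (abs_le.1 h).1]

lemma abs_clip_sub_clip_le (M x y : ℝ) : |clip M x - clip M y| ≤ |x - y| := by
  have h1 : |clip M x - clip M y| ≤ |min x M - min y M| := by
    simpa [clip] using abs_max_sub_max_le_max (-M) (min x M) (-M) (min y M)
  have h2 : |min x M - min y M| ≤ |x - y| := by
    simpa using abs_min_sub_min_le_max x M y M
  exact h1.trans h2

lemma abs_clip_le_abs {M : ℝ} (hM : 0 ≤ M) (x : ℝ) : |clip M x| ≤ |x| := by
  have h := abs_clip_sub_clip_le M x 0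
  rwa [clip_of_abs_le (x := 0) (by simpa using hM), sub_zero, sub_zero] at h

lemma eLpNorm_two_eq {Ω : Type*} {mΩ : MeasurableSpace Ω} {P : Measure Ω} [IsFiniteMeasure P]
    {Y : Ω → ℝ} (hY : BddMeas mΩ Y) :
    eLpNorm Y 2 P = ENNReal.ofReal (Real.sqrt (∫ ω, Y ω ^ 2 ∂P)) := by
  obtain ⟨hm, C, hC⟩ := hY
  have hL : MemLp Y 2 P := MemLp.of_bound hm.aestronglyMeasurable C (Filter.Eventually.of_forall hC)
  rw [hL.eLpNorm_eq_integral_rpow_norm two_ne_zero ENNReal.ofNat_ne_top, Real.sqrt_eq_rpow]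
  simp

lemma integral_sq_le_of_eLpNorm_le {Ω : Type*} {mΩ : MeasurableSpace Ω} {P : Measure Ω}
    [IsFiniteMeasure P] {X Y : Ω → ℝ} (hY : BddMeas mΩ Y) (hYX : ∀ ω, |Y ω| ≤ |X ω|) {c : ℝ}
    (hc : 0 ≤ c) (h : eLpNorm X 2 P ≤ ENNReal.ofReal c) : ∫ ω, Y ω ^ 2 ∂P ≤ c ^ 2 := by
  have h1 := (eLpNorm_mono (p := 2) (μ := P) (f := Y) (g := X) hYX).trans h
  rw [eLpNorm_two_eq hY, ENNReal.ofReal_le_ofReal_iff hc] at h1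
  exact (Real.sqrt_le_left hc).1 h1

section

variable {Ω : Type*} [mΩ : MeasurableSpace Ω] {P : Measure Ω} {d d' n : ℕ}
  {ε ε' : ℤ → Ω → Fin d' → ℝ} {J : ℤ → (ℕ → Fin d' → ℝ) → Fin d → ℝ}
  {F : Finset (Fn d)} {hF : F.Nonempty} {D : Fn d → unitInterval → ℝ} {Δ : ℕ → ℝ}
  {W : Fin n → Fn d → (ℕ → Fin d' → ℝ) → ℝ} {M : ℝ}

/-- The functionals `W`, indexed by the integer time, extended by zero outside `1, …, n` and
truncated to `[-M, M]`. -/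
def truncW (M : ℝ) (W : Fin n → Fn d → (ℕ → Fin d' → ℝ) → ℝ) (t : ℤ) (f : Fn d)
    (x : ℕ → Fin d' → ℝ) : ℝ :=
  if h : 1 ≤ t ∧ t ≤ n then clip M (W ⟨(t - 1).toNat, by omega⟩ f x) else 0

lemma truncW_time (i : Fin n) (f : Fn d) (x : ℕ → Fin d' → ℝ) :
    truncW M W (i + 1) f x = clip M (W i f x) := by
  have h : 1 ≤ (i : ℤ) + 1 ∧ (i : ℤ) + 1 ≤ n := by omega
  rw [truncW, dif_pos h]
  congr 2
  ext
  simp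

lemma abs_truncW_le (hM : 0 ≤ M) (t : ℤ) (f : Fn d) (x : ℕ → Fin d' → ℝ) :
    |truncW M W t f x| ≤ M := by
  unfold truncW
  split_ifs
  · exact abs_clip_le hM _
  · simpa using hM

lemma measurable_truncW (hW : ∀ i f, Measurable f → Measurable (W i f)) (t : ℤ) {f : Fn d}
    (hf : Measurable f) : Measurable (truncW M W t f) := by
  unfold truncW
  split_ifs
  · exact (measurable_clip M).comp (hW _ _ hf)
  · exact measurable_const

lemma measurable_obs (hε : IsInnovation P ε ε') (hJ : ∀ i, Measurable (J i)) (i : Fin n) {f : Fn d}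
    (hf : Measurable f) : Measurable (obs J ε i f) :=
  hf.comp ((measurable_pi_lambda _ fun _ => (hJ _).comp (measurable_past' hε _)).prodMk
    measurable_const)

lemma bddMeas_obs (hε : IsInnovation P ε ε') (hJ : ∀ i, Measurable (J i)) (i : Fin n) {f : Fn d}
    (hf : Measurable f) (hfM : ∀ x, |f x| ≤ M) : BddMeas mΩ (obs J ε i f) :=
  ⟨measurable_obs hε hJ i hf, M, fun _ => hfM _⟩

lemma measurable_pastStar (hε : IsInnovation P ε ε') (t : ℤ) (j : ℕ) :
    Measurable (pastStar ε ε' t j) := by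
  refine measurable_pi_lambda _ fun k => ?_
  by_cases h : k = j
  · subst h
    simpa [pastStar] using hε.measurable_copy (t - k)
  · simpa [pastStar, past, h] using hε.measurable (t - k)

/-- The centred sums of the truncated functionals. -/
def truncS (P : Measure Ω) (ε : ℤ → Ω → Fin d' → ℝ) (M : ℝ)
    (W : Fin n → Fn d → (ℕ → Fin d' → ℝ) → ℝ) (f : Fn d) (ω : Ω) : ℝ :=
  ∑ i ∈ Finset.range n, (truncW M W (i + 1) f (past ε (i + 1) ω)
    - ∫ ω', truncW M W (i + 1) f (past ε (i + 1) ω') ∂P)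

lemma bddMeas_truncS (hε : IsInnovation P ε ε') (hC : Compatible P ε ε' J F hF D Δ W)
    {f : Fn d} (hfm : Measurable f) (hM : 0 ≤ M) : BddMeas mΩ (truncS P ε M W f) :=
  BddMeas.sum fun _ _ => (bddMeas_past hε (measurable_truncW hC.measurable _ hfm)
    (abs_truncW_le hM _ f) _).sub (BddMeas.const _)

variable [IsProbabilityMeasure P]

lemma ae_truncW_eq (hC : Compatible P ε ε' J F hF D Δ W) {f : Fn d} (hf : f ∈ F)
    (hfM : ∀ x, |f x| ≤ M) (i : Fin n) :
    ∀ᵐ ω ∂P, truncW M W (i + 1) f (past ε (i + 1) ω) = Wvar ε W i f ω := by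
  have hM : 0 ≤ M := (abs_nonneg _).trans (hfM (0, 0))
  have h1 : eLpNorm (Wvar ε W i f) ∞ P ≤ ENNReal.ofReal M := by
    refine (hC.norm_le i ⊤ le_top f hf).trans ?_
    refine (eLpNorm_le_of_ae_bound (Filter.Eventually.of_forall fun ω => hfM _)).trans ?_
    simp
  rw [eLpNorm_exponent_top] at h1
  filter_upwards [ae_le_eLpNormEssSup (f := Wvar ε W i f) (μ := P)] with ω hω
  have h2 := hω.trans h1
  rw [← ofReal_norm, ENNReal.ofReal_le_ofReal_iff hM] at h2
  rw [truncW_time]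
  exact clip_of_abs_le h2

lemma integral_truncW_sq_le (hε : IsInnovation P ε ε') (hJ : ∀ i, Measurable (J i))
    (hC : Compatible P ε ε' J F hF D Δ W) {f : Fn d} (hf : f ∈ F) (hfm : Measurable f)
    (hfM : ∀ x, |f x| ≤ M) (i : Fin n) :
    ∫ ω, truncW M W (i + 1) f (past ε (i + 1) ω) ^ 2 ∂P ≤ ∫ ω, obs J ε i f ω ^ 2 ∂P := by
  have hM : 0 ≤ M := (abs_nonneg _).trans (hfM (0, 0))
  have h := hC.norm_le i 2 (by norm_num) f hf
  have h2 : ((2 : ℕ∞) : ℝ≥0∞) = 2 := rfl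
  rw [h2, eLpNorm_two_eq (bddMeas_obs hε hJ i hfm hfM)] at h
  refine (integral_sq_le_of_eLpNorm_le (bddMeas_past hε (measurable_truncW hC.measurable _ hfm)
    (abs_truncW_le hM _ f) _) (fun ω => ?_) (Real.sqrt_nonneg _) h).trans_eq
    (Real.sq_sqrt (integral_nonneg fun ω => sq_nonneg _))
  rw [truncW_time]
  exact abs_clip_le_abs hM _

lemma integral_truncW_sub_sq_le (hε : IsInnovation P ε ε') (hΔ : ∀ k, 0 ≤ Δ k)
    (hC : Compatible P ε ε' J F hF D Δ W) {f : Fn d} (hf : f ∈ F) (hfm : Measurable f)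
    (hM : 0 ≤ M) (i : Fin n) {j : ℕ} (hj : 1 ≤ j) :
    ∫ ω, (truncW M W (i + 1) f (past ε (i + 1) ω)
      - truncW M W (i + 1) f (pastStar ε ε' (i + 1) j ω)) ^ 2 ∂P ≤
      (|D f (grid i)| * Δ j) ^ 2 := by
  have hm := measurable_truncW (M := M) hC.measurable (i + 1) hfm
  refine integral_sq_le_of_eLpNorm_le (BddMeas.sub (bddMeas_past hε hm (abs_truncW_le hM _ f) _)
    ⟨hm.comp (measurable_pastStar hε _ _), M, fun _ => abs_truncW_le hM _ _ _⟩) (fun ω => ?_)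
    (mul_nonneg (abs_nonneg _) (hΔ j)) (hC.dep i j hj f hf)
  simp only [Function.comp, truncW_time]
  exact abs_clip_sub_clip_le _ _ _

lemma integral_sup_truncW_sub_sq_le (hε : IsInnovation P ε ε') (hΔ : ∀ k, 0 ≤ Δ k)
    (hC : Compatible P ε ε' J F hF D Δ W) (hfm : ∀ f ∈ F, Measurable f)
    (hM : 0 ≤ M) (i : Fin n) {j : ℕ} (hj : 1 ≤ j) :
    ∫ ω, (F.sup' hF fun f => |truncW M W (i + 1) f (past ε (i + 1) ω)
      - truncW M W (i + 1) f (pastStar ε ε' (i + 1) j ω)|) ^ 2 ∂P ≤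
      (Dinf F hF D (grid i) * Δ j) ^ 2 := by
  have hm := fun f hf => measurable_truncW (M := M) hC.measurable (i + 1) (hfm f hf)
  have h0 : 0 ≤ Dinf F hF D (grid i) := by
    obtain ⟨f, hf⟩ := hF
    exact (abs_nonneg _).trans (Finset.le_sup' (fun f => |D f (grid i)|) hf)
  refine integral_sq_le_of_eLpNorm_le (BddMeas.sup' hF fun f hf => (BddMeas.sub
    (bddMeas_past hε (hm f hf) (abs_truncW_le hM _ f) _)
    ⟨(hm f hf).comp (measurable_pastStar hε _ _), M, fun _ => abs_truncW_le hM _ _ _⟩).abs)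
    (fun ω => ?_) (mul_nonneg h0 (hΔ j)) (hC.sup_dep i j hj)
  have hsup0 : ∀ X : Fn d → ℝ, 0 ≤ F.sup' hF fun f => |X f| := fun X => by
    obtain ⟨f, hf⟩ := hF
    exact (abs_nonneg _).trans (Finset.le_sup' (fun f => |X f|) hf)
  rw [abs_of_nonneg (hsup0 _), abs_of_nonneg (hsup0 _)]
  refine Finset.sup'_mono_fun fun f _ => ?_
  simp only [Function.comp, truncW_time]
  exact abs_clip_sub_clip_le _ _ _

/-! ### The bound for a fixed number of innovations -/

lemma sum_sq_le_of_sqrt_le (hn : 1 ≤ n) {x : Fin n → ℝ} {c : ℝ}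
    (h : Real.sqrt ((n : ℝ)⁻¹ * ∑ i, x i) ≤ c) : ∑ i, x i ≤ (Real.sqrt n * c) ^ 2 := by
  have hn0 : (0 : ℝ) < n := by exact_mod_cast hn
  have hc : 0 ≤ c := (Real.sqrt_nonneg _).trans h
  have h1 := (Real.sqrt_le_left hc).1 h
  rw [mul_pow, Real.sq_sqrt hn0.le]
  rwa [inv_mul_le_iff₀ hn0] at h1

lemma one_le_H : 1 ≤ H F := le_max_left _ _

lemma log_two_mul_card_le (hF : F.Nonempty) : Real.log (2 * F.card) ≤ 2 * H F := by
  have hF1 : (1 : ℝ) ≤ F.card := by exact_mod_cast hF.card_pos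
  rw [Real.log_mul two_ne_zero (by linarith)]
  have h1 : Real.log F.card ≤ H F := le_max_right _ _
  have h2 := one_le_H (F := F)
  have h3 := Real.log_two_lt_d9
  linarith

lemma sqrt_log_two_mul_card_le (hF : F.Nonempty) :
    Real.sqrt (Real.log (2 * F.card)) ≤ 2 * Real.sqrt (H F) := by
  have h1 := one_le_H (F := F)
  refine (Real.sqrt_le_left (by positivity)).2 ?_
  rw [mul_pow, Real.sq_sqrt (by linarith)]
  linarith [log_two_mul_card_le hF]

lemma maxS_ae_eq (hC : Compatible P ε ε' J F hF D Δ W) (hfM : ∀ f ∈ F, ∀ x, |f x| ≤ M) :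
    maxS P ε W F hF =ᵐ[P] fun ω => (Real.sqrt n)⁻¹ * F.sup' hF fun f => |truncS P ε M W f ω| := by
  have hall : ∀ᵐ ω ∂P, ∀ f ∈ F, ∀ i : Fin n,
      truncW M W (i + 1) f (past ε (i + 1) ω) = Wvar ε W i f ω := by
    rw [Filter.eventually_all_finset]
    exact fun f hf => ae_all_iff.2 fun i => ae_truncW_eq hC hf (hfM f hf) i
  filter_upwards [hall] with ω hω
  have e : ∀ f ∈ F, truncS P ε M W f ω = S P ε W f ω := fun f hf => by
    rw [truncS, S, Finset.sum_range]
    refine Finset.sum_congr rfl fun i _ => ?_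
    rw [hω f hf i, integral_congr_ae (ae_truncW_eq hC hf (hfM f hf) i)]
  have hn : 0 ≤ (Real.sqrt n)⁻¹ := by positivity
  rw [maxS, Finset.mul₀_sup' hn]
  refine Finset.sup'_congr hF rfl fun f hf => ?_
  rw [e f hf, abs_div, abs_of_nonneg (Real.sqrt_nonneg _), div_eq_inv_mul]

lemma integrable_maxS (hε : IsInnovation P ε ε') (hC : Compatible P ε ε' J F hF D Δ W)
    (hfm : ∀ f ∈ F, Measurable f) (hM : 0 ≤ M) (hfM : ∀ f ∈ F, ∀ x, |f x| ≤ M) :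
    Integrable (maxS P ε W F hF) P :=
  (integrable_congr (maxS_ae_eq hC hfM)).2 ((BddMeas.sup' hF fun f hf =>
    (bddMeas_truncS hε hC (hfm f hf) hM).abs).const_mul _).integrable

lemma integral_maxS (hC : Compatible P ε ε' J F hF D Δ W) (hfM : ∀ f ∈ F, ∀ x, |f x| ≤ M) :
    ∫ ω, maxS P ε W F hF ω ∂P = (Real.sqrt n)⁻¹ * maxNorm P F hF (truncS P ε M W) := by
  rw [integral_congr_ae (maxS_ae_eq hC hfM), integral_const_mul]
  rfl

/-- The bound at depth `q`. It holds for every `q ≥ 1`, also beyond `n`. -/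
theorem integral_maxS_le (hn : 1 ≤ n) (hε : IsInnovation P ε ε') (hJ : ∀ i, Measurable (J i))
    (hC : Compatible P ε ε' J F hF D Δ W) (hfm : ∀ f ∈ F, Measurable f)
    (hΔ0 : ∀ k, 0 ≤ Δ k) (hΔ : Summable Δ) {Dn DnInf : ℝ}
    (hDn : ∀ f ∈ F, Real.sqrt ((n : ℝ)⁻¹ * ∑ i : Fin n, (D f (grid i)) ^ 2) ≤ Dn)
    (hDnInf : Real.sqrt ((n : ℝ)⁻¹ * ∑ i : Fin n, (Dinf F hF D (grid i)) ^ 2) ≤ DnInf)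
    (hM : 0 ≤ M) (hfM : ∀ f ∈ F, ∀ x, |f x| ≤ M) {σ : ℝ}
    (hV : ∀ f ∈ F, V P n J ε Δ Dn f ≤ σ) {q : ℕ} (hq : 1 ≤ q) :
    ∫ ω, maxS P ε W F hF ω ∂P ≤ 16 * (σ * Real.sqrt (H F)
      + Real.sqrt (H F) * DnInf * beta Δ q + q * M * H F / Real.sqrt n) := by
  have hn0 : (0 : ℝ) < n := by exact_mod_cast hn
  have hsn : 0 < Real.sqrt n := Real.sqrt_pos.2 hn0
  have hDnInf0 : 0 ≤ DnInf := (Real.sqrt_nonneg _).trans hDnInf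
  have hDn0 : 0 ≤ Dn := by
    obtain ⟨f, hf⟩ := hF
    exact (Real.sqrt_nonneg _).trans (hDn f hf)
  have hG : ∀ t : ℤ, ∀ f ∈ F, Measurable (truncW M W t f) :=
    fun t f hf => measurable_truncW hC.measurable t (hfm f hf)
  have hGM : ∀ t : ℤ, ∀ f ∈ F, ∀ x, |truncW M W t f x| ≤ M := fun t f _ => abs_truncW_le hM t f
  -- all the norms `‖f‖_{2,n}` are replaced by the largest of them
  obtain ⟨f₀, hf₀, hmax⟩ := F.exists_max_image (normTwo P n J ε) hF
  set N := normTwo P n J ε f₀ with hN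
  have hN0 : 0 ≤ N := Real.sqrt_nonneg _
  set a : ℕ → ℝ := fun m => if m = 0 then N else min N (Dn * Δ m) with ha
  have ha0 : ∀ m, 0 ≤ a m := fun m => by
    simp only [ha]
    split_ifs
    · exact hN0
    · exact le_min hN0 (mul_nonneg hDn0 (hΔ0 m))
  have hmin0 : ∀ k : ℕ, 0 ≤ min N (Dn * Δ (k + 1)) :=
    fun k => le_min hN0 (mul_nonneg hDn0 (hΔ0 _))
  have hsummin : Summable fun k : ℕ => min N (Dn * Δ (k + 1)) :=
    Summable.of_nonneg_of_le hmin0 (fun k => min_le_right _ _)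
      (((summable_nat_add_iff 1).2 hΔ).mul_left Dn)
  have haσ : ∑ m ∈ Finset.range q, a m ≤ σ := by
    obtain ⟨q, rfl⟩ : ∃ q', q = q' + 1 := ⟨q - 1, by omega⟩
    rw [Finset.sum_range_succ', add_comm]
    refine le_trans ?_ (hV f₀ hf₀)
    have h1 := hsummin.sum_le_tsum (Finset.range q) fun k _ => hmin0 k
    simpa [ha, V, ← hN] using h1
  have hbound1 : ∀ f ∈ F, ∀ m, ∑ i ∈ Finset.range n,
      ∫ ω, incr P ε (truncW M W (i + 1) f) (i + 1) m ω ^ 2 ∂P ≤ (Real.sqrt n * N) ^ 2 := by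
    intro f hf m
    rw [Finset.sum_range]
    refine (Finset.sum_le_sum fun i _ => (integral_incr_sq_le hε (hG _ f hf) (hGM _ f hf) _ m).trans
      (integral_truncW_sq_le hε hJ hC hf (hfm f hf) (hfM f hf) i)).trans ?_
    exact sum_sq_le_of_sqrt_le hn (hmax f hf)
  have hbound2 : ∀ f ∈ F, ∀ m, 1 ≤ m → ∑ i ∈ Finset.range n,
      ∫ ω, incr P ε (truncW M W (i + 1) f) (i + 1) m ω ^ 2 ∂P ≤
      (Real.sqrt n * (Dn * Δ m)) ^ 2 := by
    intro f hf m hm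
    rw [Finset.sum_range]
    have h1 : ∀ i : Fin n, ∫ ω, incr P ε (truncW M W (i + 1) f) (i + 1) m ω ^ 2 ∂P ≤
        D f (grid i) ^ 2 * Δ m ^ 2 := fun i => by
      have h2 := integral_sup_incr_sq_le (P := P) (Finset.singleton_nonempty f) hε
        (G := fun f => truncW M W (i + 1) f) (M := M)
        (fun g hg => hG _ g (Finset.mem_singleton.1 hg ▸ hf))
        (fun g hg => hGM _ g (Finset.mem_singleton.1 hg ▸ hf)) (i + 1) m
      simp only [Finset.sup'_singleton, sq_abs] at h2
      refine (h2.trans (integral_truncW_sub_sq_le hε hΔ0 hC hf (hfm f hf) hM i hm)).trans_eq ?_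
      rw [mul_pow, sq_abs]
    refine (Finset.sum_le_sum fun i _ => h1 i).trans ?_
    rw [← Finset.sum_mul, ← mul_assoc, mul_pow _ (Δ m)]
    exact mul_le_mul_of_nonneg_right
      (sum_sq_le_of_sqrt_le hn (hDn f hf)) (sq_nonneg _)
  have hA : ∀ m, ∀ f ∈ F, ∑ i ∈ Finset.range n,
      ∫ ω, incr P ε (truncW M W (i + 1) f) (i + 1) m ω ^ 2 ∂P ≤ (Real.sqrt n * a m) ^ 2 := by
    intro m f hf
    rcases Nat.eq_zero_or_pos m with rfl | hm
    · exact hbound1 f hf 0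
    · simp only [ha, hm.ne', if_false]
      rcases min_choice N (Dn * Δ m) with h | h <;> rw [h]
      · exact hbound1 f hf m
      · exact hbound2 f hf m hm
  have hv : ∀ m, q ≤ m → ∑ i ∈ Finset.range n, ∫ ω, (F.sup' hF fun f =>
      |incr P ε (truncW M W (i + 1) f) (i + 1) m ω|) ^ 2 ∂P ≤
      (Real.sqrt n * DnInf * Δ m) ^ 2 := by
    intro m hm
    rw [Finset.sum_range]
    have h1 : ∀ i : Fin n, ∫ ω, (F.sup' hF fun f =>
        |incr P ε (truncW M W (i + 1) f) (i + 1) m ω|) ^ 2 ∂P ≤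
        Dinf F hF D (grid i) ^ 2 * Δ m ^ 2 := fun i => by
      rw [← mul_pow]
      exact (integral_sup_incr_sq_le hF hε (G := fun f => truncW M W (i + 1) f)
        (fun f hf => hG _ f hf) (fun f hf => hGM _ f hf) (i + 1) m).trans
        (integral_sup_truncW_sub_sq_le hε hΔ0 hC hfm hM i (hq.trans hm))
    refine (Finset.sum_le_sum fun i _ => h1 i).trans ?_
    rw [← Finset.sum_mul, mul_pow _ (Δ m)]
    exact mul_le_mul_of_nonneg_right
      (sum_sq_le_of_sqrt_le hn hDnInf) (sq_nonneg _)
  have hβ : ∀ K, ∑ m ∈ Finset.Ico q K, Real.sqrt n * DnInf * Δ m ≤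
      Real.sqrt n * DnInf * beta Δ q := by
    intro K
    rw [← Finset.mul_sum, Finset.sum_Ico_eq_sum_range]
    refine mul_le_mul_of_nonneg_left ?_ (by positivity)
    have hs : Summable fun j => Δ (q + j) := by
      simpa only [add_comm] using (summable_nat_add_iff q).2 hΔ
    exact hs.sum_le_tsum _ fun j _ => hΔ0 _
  have hmain := maxNorm_sum_sub_integral_le hF hε hG hGM hM n q
    (A := fun m => Real.sqrt n * a m) (fun m => mul_nonneg hsn.le (ha0 m)) hA
    (v := fun m => Real.sqrt n * DnInf * Δ m) (fun m => by have := hΔ0 m; positivity) hv hβ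
  rw [integral_maxS hC hfM, inv_mul_le_iff₀ hsn]
  refine (hmain : maxNorm P F hF (truncS P ε M W) ≤ _).trans ?_
  rw [← Finset.mul_sum]
  have hL := log_two_mul_card_le hF
  have hsL := sqrt_log_two_mul_card_le hF
  have hH := one_le_H (F := F)
  have hσ0 : 0 ≤ σ := (Finset.sum_nonneg fun m _ => ha0 m).trans haσ
  have hβ0 : 0 ≤ beta Δ q := tsum_nonneg fun j => hΔ0 _
  have t1 : 4 * Real.sqrt (Real.log (2 * F.card)) * (Real.sqrt n * ∑ m ∈ Finset.range q, a m) ≤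
      4 * (2 * Real.sqrt (H F)) * (Real.sqrt n * σ) :=
    mul_le_mul (by linarith) (mul_le_mul_of_nonneg_left haσ hsn.le)
      (mul_nonneg hsn.le (Finset.sum_nonneg fun m _ => ha0 m)) (by positivity)
  have t2 : 5 * Real.sqrt (Real.log (2 * F.card)) * (Real.sqrt n * DnInf * beta Δ q) ≤
      5 * (2 * Real.sqrt (H F)) * (Real.sqrt n * DnInf * beta Δ q) :=
    mul_le_mul_of_nonneg_right (by linarith) (by positivity)
  have t3 : 8 * q * M * Real.log (2 * F.card) ≤ 8 * q * M * (2 * H F) :=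
    mul_le_mul_of_nonneg_left hL (by positivity)
  have e : Real.sqrt n * (16 * (σ * Real.sqrt (H F) + Real.sqrt (H F) * DnInf * beta Δ q
      + q * M * H F / Real.sqrt n)) = 16 * (Real.sqrt (H F)) * (Real.sqrt n * σ)
      + 16 * Real.sqrt (H F) * (Real.sqrt n * DnInf * beta Δ q) + 16 * q * M * H F := by
    field_simp
  rw [e]
  have p1 : 0 ≤ Real.sqrt (H F) * (Real.sqrt n * σ) := by positivity
  have p2 : 0 ≤ Real.sqrt (H F) * (Real.sqrt n * DnInf * beta Δ q) := by positivity
  linarith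

/-! ### The optimal number of innovations -/

lemma qStar_spec {x : ℝ} (hx : 0 < x) : 1 ≤ qStar Δ x ∧ beta Δ (qStar Δ x) ≤ qStar Δ x * x := by
  have h0 : Filter.Tendsto (beta Δ) Filter.atTop (nhds 0) := by
    have h := _root_.tendsto_sum_nat_add Δ
    refine h.congr fun q => tsum_congr fun k => ?_
    rw [add_comm]
  have hne : {q : ℕ | 1 ≤ q ∧ beta Δ q ≤ q * x}.Nonempty := by
    obtain ⟨q, hq, hq1⟩ := ((h0.eventually (gt_mem_nhds hx)).and
      (Filter.eventually_ge_atTop 1)).exists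
    have h1 : (1 : ℝ) ≤ q := by exact_mod_cast hq1
    exact ⟨q, hq1, by nlinarith⟩
  exact Nat.sInf_mem hne

end

end

end MaximalInequality

theorem mainTheorem5 :
    ∃ c : ℝ, 0 < c ∧
      ∀ (d d' n : ℕ) (hn : 1 ≤ n)
        (Ω : Type*) [MeasurableSpace Ω] (P : Measure Ω) [IsProbabilityMeasure P]
        (ε ε' : ℤ → Ω → Fin d' → ℝ) (_ : MaximalInequality.IsInnovation P ε ε')
        (J : ℤ → (ℕ → Fin d' → ℝ) → Fin d → ℝ) (_ : ∀ i, Measurable (J i))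
        (F : Finset (MaximalInequality.Fn d)) (hF : F.Nonempty) (_ : ∀ f ∈ F, Measurable f)
        -- the decomposition f(z, u) = D_f(u) * fbar(z, u)
        (D : MaximalInequality.Fn d → unitInterval → ℝ)
        (fbar : MaximalInequality.Fn d → MaximalInequality.Fn d)
        (_ : ∀ f ∈ F, ∀ z u, f (z, u) = D f u * fbar f (z, u))
        (Δ : ℕ → ℝ) (_ : Antitone Δ) (_ : ∀ k, 0 ≤ Δ k) (_ : Summable Δ)
        (Dn DnInf : ℝ)
        (_ : ∀ f ∈ F, Real.sqrt ((n : ℝ)⁻¹ *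
          ∑ i : Fin n, (D f (MaximalInequality.grid i)) ^ 2) ≤ Dn)
        (_ : Real.sqrt ((n : ℝ)⁻¹ *
          ∑ i : Fin n, (MaximalInequality.Dinf F hF D (MaximalInequality.grid i)) ^ 2) ≤ DnInf)
        (W : Fin n → MaximalInequality.Fn d → (ℕ → Fin d' → ℝ) → ℝ)
        (_ : MaximalInequality.Compatible P ε ε' J F hF D Δ W)
        (M σ : ℝ) (_ : ∀ f ∈ F, ∀ x, |f x| ≤ M)
        (_ : ∀ f ∈ F, MaximalInequality.V P n J ε Δ Dn f ≤ σ),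
        Integrable (MaximalInequality.maxS P ε W F hF) P ∧
        ∫ ω, MaximalInequality.maxS P ε W F hF ω ∂P ≤
          c * (Finset.Icc 1 n).inf' (Finset.nonempty_Icc.2 hn) (fun q : ℕ =>
            σ * Real.sqrt (MaximalInequality.H F)
              + Real.sqrt (MaximalInequality.H F) * DnInf * MaximalInequality.beta Δ q
              + q * M * MaximalInequality.H F / Real.sqrt n) ∧
        (0 < M → 0 < DnInf →
          ∫ ω, MaximalInequality.maxS P ε W F hF ω ∂P ≤
            2 * c * (σ * Real.sqrt (MaximalInequality.H F)
              + MaximalInequality.qStar Δ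
                  (M * Real.sqrt (MaximalInequality.H F) / (Real.sqrt n * DnInf))
                * (M * MaximalInequality.H F / Real.sqrt n))) := by
  refine ⟨16, by norm_num, ?_⟩
  intro d d' n hn Ω _ P _ ε ε' hε J hJ F hF hfm D fbar _ Δ _ hΔ0 hΔ Dn DnInf hDn hDnInf W hC M σ
    hfM hV
  have hM : 0 ≤ M := by
    obtain ⟨f, hf⟩ := hF
    exact (abs_nonneg _).trans (hfM f hf (0, 0))
  have hbound : ∀ q : ℕ, 1 ≤ q → ∫ ω, MaximalInequality.maxS P ε W F hF ω ∂P ≤ 16 *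
      (σ * Real.sqrt (MaximalInequality.H F)
        + Real.sqrt (MaximalInequality.H F) * DnInf * MaximalInequality.beta Δ q
        + q * M * MaximalInequality.H F / Real.sqrt n) := fun q hq =>
    MaximalInequality.integral_maxS_le hn hε hJ hC hfm hΔ0 hΔ hDn hDnInf hM hfM hV hq
  refine ⟨MaximalInequality.integrable_maxS hε hC hfm hM hfM, ?_, fun hM' hD' => ?_⟩
  · obtain ⟨q, hq, hqe⟩ := (Finset.Icc 1 n).exists_mem_eq_inf' (Finset.nonempty_Icc.2 hn)
      (fun q : ℕ => σ * Real.sqrt (MaximalInequality.H F)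
        + Real.sqrt (MaximalInequality.H F) * DnInf * MaximalInequality.beta Δ q
        + q * M * MaximalInequality.H F / Real.sqrt n)
    rw [hqe]
    exact hbound q (Finset.mem_Icc.1 hq).1
  · have hn0 : (0 : ℝ) < n := by exact_mod_cast hn
    have hsn : 0 < Real.sqrt n := Real.sqrt_pos.2 hn0
    have hH : 1 ≤ MaximalInequality.H F := MaximalInequality.one_le_H
    have hsH : 0 < Real.sqrt (MaximalInequality.H F) := Real.sqrt_pos.2 (by linarith)
    set x := M * Real.sqrt (MaximalInequality.H F) / (Real.sqrt n * DnInf) with hx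
    have hx0 : 0 < x := by positivity
    obtain ⟨hq1, hq2⟩ := MaximalInequality.qStar_spec (Δ := Δ) hx0
    set q := MaximalInequality.qStar Δ x with hq
    -- by the choice of `x`, the second term is at most the third at depth `q`; the bound at depth
    -- `q` is available even if `q > n`, where it is not part of the minimum over `1, …, n`
    have h1 : Real.sqrt (MaximalInequality.H F) * DnInf * MaximalInequality.beta Δ q ≤
        q * (M * MaximalInequality.H F / Real.sqrt n) := by
      refine (mul_le_mul_of_nonneg_left hq2 (by positivity)).trans_eq ?_
      have hs2 : Real.sqrt (MaximalInequality.H F) ^ 2 = MaximalInequality.H F :=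
        Real.sq_sqrt (by linarith)
      rw [hx]
      field_simp
      rw [hs2]
    have h2 := hbound q hq1
    have h3 : (q : ℝ) * M * MaximalInequality.H F / Real.sqrt n
        = q * (M * MaximalInequality.H F / Real.sqrt n) := by ring
    have hσ0 : 0 ≤ σ := by
      obtain ⟨f, hf⟩ := hF
      refine le_trans (add_nonneg (Real.sqrt_nonneg _) (tsum_nonneg fun k => ?_)) (hV f hf)
      exact le_min (Real.sqrt_nonneg _)
        (mul_nonneg ((Real.sqrt_nonneg _).trans (hDn f hf)) (hΔ0 _))
    have h4 : 0 ≤ σ * Real.sqrt (MaximalInequality.H F) := by positivity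
    linarith
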